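/- Let $d\in\mathbb N$, $s>0$, $T>0$. For $\sigma>0$ let $(-\Delta)^{\sigma}v=\mathcal F^{-1}(|\xi|^{2\sigma}\hat v)$, let $H^s(\mathbb R^d)$ be the space of $v\in L^2(\mathbb R^d)$ (complex valued) with $\|v\|_{H^s}^2=\int(1+|\xi|^{2s})|\hat v(\xi)|^2\,d\xi<\infty$, and put $D_g^s v=(-\Delta)^{s/2}\big(g\,(-\Delta)^{s/2}v\big)$. Let $g,m,b$ be real-valued distributions on $\mathbb R^d$, let $u_0,u_1$ be complex-valued distributions on $\mathbb R^d$, and let $f(t,\cdot)$, $t\in[0,T]$, be complex-valued distributions on $\mathbb R^d$. A regularisation of a distribution $S$ is a net $S_\varepsilon=S*\psi_\varepsilon$, $\varepsilon\in(0,1]$, where $\psi_\varepsilon(x)=\varepsilon^{-d}\psi(x/\varepsilon)$ and $0\le\psi\in C_c^\infty(\mathbb R^d)$, $\int\psi=1$; for $f$ the convolution is in $x$, with the same $\psi$ for all $t$. A net $(h_\varepsilon)_{\varepsilon\in(0,1]}$ in a normed space $X$ is $X$-moderate if there are $N\in\mathbb N^*$ and $C>0$ with $\|h_\varepsilon\|_X\le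 C\varepsilon^{-N}$ for all $\varepsilon\in(0,1]$. A net $(f_\varepsilon)$ of sources is called $L^2$-moderate if $f_\varepsilon\in C([0,T];L^2(\mathbb R^d))$ and $\sup_{t\in[0,T]}\|f_\varepsilon(t,\cdot)\|_{L^2}\le C\varepsilon^{-N}$ for all $\varepsilon\in(0,1]$. A net $(u_\varepsilon)$ in $C([0,T];H^s(\mathbb R^d))\cap C^1([0,T];L^2(\mathbb R^d))$ is moderate if $$\sup_{t\in[0,T]}\big(\|u_\varepsilon(t,\cdot)\|_{L^2}+\|(-\Delta)^{s/2}u_\varepsilon(t,\cdot)\|_{L^2}+\|\partial_tu_\varepsilon(t,\cdot)\|_{L^2}\big)\le C\varepsilon^{-N}\qquad(\varepsilon\in(0,1])$$ for some $N\in\mathbb N^*$, $C>0$. A net $(u_\varepsilon)_{\varepsilon\in(0,1]}$ in $C([0,T];H^s)\cap C^1([0,T];L^2)$ is a very weak solution of $$u_{tt}+D_g^su+m\,u+b\,u_t=f,\qquad u(0)=u_0,\quad u_t(0)=u_1 \tag{1}$$ if it is moderate and there are regularisations $g_\varepsilon,m_\varepsilon,b_\varepsilon$ ($L^\infty$-moderate,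 with $g_\varepsilon>0$, $m_\varepsilon\ge0$, $b_\varepsilon\ge0$), $f_\varepsilon$ ($L^2$-moderate), $u_{0,\varepsilon}$ ($H^s$-moderate) and $u_{1,\varepsilon}$ ($L^2$-moderate) of $g,m,b,f,u_0,u_1$ such that, for every $\varepsilon\in(0,1]$, $$\partial_t^2u_\varepsilon+D_{g_\varepsilon}^su_\varepsilon+m_\varepsilon u_\varepsilon+b_\varepsilon\,\partial_tu_\varepsilon=f_\varepsilon \ \text{ on } [0,T]\times\mathbb R^d,\qquad u_\varepsilon(0)=u_{0,\varepsilon},\quad \partial_tu_\varepsilon(0)=u_{1,\varepsilon}, \tag{2}$$ where the equation holds in $H^{-s}(\mathbb R^d)$, i.e. in the $L^2$ pairing with every $\varphi\in H^s(\mathbb R^d)$, at every $t\in[0,T]$. **Theorem.** Suppose that $g,m,b,f,u_0,u_1$ have regularisations $g_\varepsilon,m_\varepsilon,b_\varepsilon,f_\varepsilon,u_{0,\varepsilon},u_{1,\varepsilon}$ that are moderate in $L^\infty$, $L^\infty$, $L^\infty$, $L^2$, $H^s$ and $L^2$ respectively, with $g_\varepsilon>0$, $m_\varepsilon\ge0$,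 $b_\varepsilon\ge0$. Suppose moreover that $g_\varepsilon$ is bounded from below in the following sense: there are $c>0$ and $N\in\mathbb N_0$ with $g_\varepsilon(x)\ge c\,\varepsilon^{N}$ for all $x\in\mathbb R^d$, $\varepsilon\in(0,1]$ (for instance $g_\varepsilon\ge c_0>0$ with $c_0$ independent of $\varepsilon$). Then the Cauchy problem (1) has a very weak solution $(u_\varepsilon)_{\varepsilon\in(0,1]}$, and $u_\varepsilon$ solves (2) for these given regularisations, for every $\varepsilon\in(0,1]$. -/

import Mathlib

open MeasureTheory Set Filter Topology
open scoped ENNReal FourierTransform Distributions ComplexConjugate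

namespace VeryWeak

/-- The space `ℝ^d` with its Euclidean norm. -/
abbrev Space (d : ℕ) : Type := EuclideanSpace ℝ (Fin d)

/-- The space `L²(ℝ^d)` of complex-valued functions. -/
abbrev L2 (d : ℕ) : Type := Lp (α := Space d) ℂ 2 volume

/-! ### The fractional Laplacian and the fractional Sobolev space -/

/-- The symbol `|η|^{2σ}` of `(-Δ)^σ`. The Fourier transform of Mathlib is
`∫ e^{-2πi⟨x,ξ⟩} f(x) dx`, so that the angular frequency is `η = 2πξ`. -/
noncomputable def fracSymbol {d : ℕ} (σ : ℝ) (ξ : Space d) : ℝ :=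
  (2 * Real.pi * ‖ξ‖) ^ (2 * σ)

open Classical in
/-- The fractional Laplacian `(-Δ)^σ f = 𝓕⁻¹ (|η|^{2σ} 𝓕 f)`, as an operator in `L²(ℝ^d)` with
domain the functions `f` for which `|η|^{2σ} 𝓕 f` is in `L²` (and the value `0` outside of it). -/
noncomputable def fracLaplacian {d : ℕ} (σ : ℝ) (f : L2 d) : L2 d :=
  if h : MemLp (fun ξ : Space d => (fracSymbol σ ξ : ℂ) * (𝓕 f : L2 d) ξ) 2 volume then
    𝓕⁻ (h.toLp _ : L2 d)
  else 0

/-- The norm `(∫ (1 + |η|^{2s}) |𝓕 f|²)^{1/2}` of `H^s(ℝ^d)`; it is `∞` if `f` is not in `H^s`. -/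
noncomputable def hsENorm {d : ℕ} (s : ℝ) (f : L2 d) : ℝ≥0∞ :=
  (∫⁻ ξ : Space d, ENNReal.ofReal (1 + fracSymbol s ξ) * ‖(𝓕 f : L2 d) ξ‖ₑ ^ 2) ^ (1 / 2 : ℝ)

/-- `f ∈ H^s(ℝ^d)`. -/
def MemHs {d : ℕ} (s : ℝ) (f : L2 d) : Prop := hsENorm s f < ∞

/-! ### The solution space and its norm -/

/-- The time derivative on `[0,T]` of an `L²`-valued function. -/
noncomputable def timeDeriv {d : ℕ} (T : ℝ) (u : ℝ → L2 d) (t : ℝ) : L2 d :=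
  derivWithin u (Icc 0 T) t

/-- `u ∈ C([0,T]; H^s(ℝ^d)) ∩ C¹([0,T]; L²(ℝ^d))`. -/
structure MemC1 {d : ℕ} (s T : ℝ) (u : ℝ → L2 d) : Prop where
  memHs : ∀ t ∈ Icc 0 T, MemHs s (u t)
  continuousHs : ∀ t ∈ Icc 0 T,
    Tendsto (fun τ => hsENorm s (u τ - u t)) (𝓝[Icc 0 T] t) (𝓝 0)
  contDiffL2 : ContDiffOn ℝ 1 u (Icc 0 T)

/-- `‖u(t,·)‖₁ = ‖u(t,·)‖_{L²} + ‖(-Δ)^{s/2} u(t,·)‖_{L²} + ‖u_t(t,·)‖_{L²}`. -/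
noncomputable def norm1 {d : ℕ} (s T : ℝ) (u : ℝ → L2 d) (t : ℝ) : ℝ :=
  ‖u t‖ + ‖fracLaplacian (s / 2) (u t)‖ + ‖timeDeriv T u t‖

/-! ### The Cauchy problem with regular coefficients and data -/

/-- `u ∈ C([0,T]; H^s) ∩ C¹([0,T]; L²)` solves
`u_tt + (-Δ)^{s/2} (g (-Δ)^{s/2} u) + m u + b u_t = f` on `[0,T] × ℝ^d`, `u(0) = v₀`,
`u_t(0) = v₁`. The equation holds in the dual `H^{-s}` of `H^s` at every time, that is,
it is tested against every `φ ∈ H^s` in the `L²` pairing. -/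
structure IsSolution {d : ℕ} (s T : ℝ) (g m b : Space d → ℝ) (f : ℝ → Space d → ℂ)
    (v₀ v₁ : Space d → ℂ) (u : ℝ → L2 d) : Prop where
  memC1 : MemC1 s T u
  equation : ∀ φ : L2 d, MemHs s φ → ∀ t ∈ Icc 0 T,
    HasDerivWithinAt (fun τ => ∫ x, timeDeriv T u τ x * conj (φ x))
      ((∫ x, f t x * conj (φ x))
        - (∫ x, (g x : ℂ) * fracLaplacian (s / 2) (u t) x * conj (fracLaplacian (s / 2) φ x))
        - (∫ x, (m x : ℂ) * u t x * conj (φ x))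
        - (∫ x, (b x : ℂ) * timeDeriv T u t x * conj (φ x)))
      (Icc 0 T) t
  initial : u 0 =ᵐ[volume] v₀
  initialDeriv : timeDeriv T u 0 =ᵐ[volume] v₁

/-! ### Regularisation by convolution with a mollifying net -/

/-- A mollifier: a smooth compactly supported function `ψ ≥ 0` with `∫ ψ = 1`. -/
structure IsMollifier {d : ℕ} (ψ : 𝓓((⊤ : TopologicalSpace.Opens (Space d)), ℝ)) : Prop where
  nonneg : ∀ x, 0 ≤ ψ x
  integral_eq_one : ∫ x, ψ x = 1

/-- The test function `y ↦ ψ_ε(x - y)`, where `ψ_ε(z) = ε^{-d} ψ(ε^{-1} z)`. -/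
noncomputable def mollifierAt {d : ℕ} (ψ : 𝓓((⊤ : TopologicalSpace.Opens (Space d)), ℝ))
    (ε : ℝ) (hε : 0 < ε) (x : Space d) : 𝓓((⊤ : TopologicalSpace.Opens (Space d)), ℝ) where
  toFun y := (ε ^ d)⁻¹ * ψ (ε⁻¹ • (x - y))
  contDiff' := by
    have h := ψ.contDiff
    exact contDiff_const.mul (h.comp (by fun_prop))
  hasCompactSupport' := by
    have h := ψ.hasCompactSupport.comp_homeomorph
      ((Homeomorph.subLeft x).trans (Homeomorph.smulOfNeZero ε⁻¹ (inv_ne_zero hε.ne')))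
    exact h.mul_left (f := fun _ => (ε ^ d)⁻¹)
  tsupport_subset' := by simp

/-- The convolution `(S * ψ_ε)(x) = ⟨S, ψ_ε(x - ·)⟩` of a distribution `S` on `ℝ^d`. -/
noncomputable def mollify {d : ℕ} {F : Type} [NormedAddCommGroup F] [NormedSpace ℝ F]
    (S : 𝓓'((⊤ : TopologicalSpace.Opens (Space d)), F))
    (ψ : 𝓓((⊤ : TopologicalSpace.Opens (Space d)), ℝ)) (ε : ℝ) (hε : 0 < ε) (x : Space d) : F :=
  S (mollifierAt ψ ε hε x)

/-- The net `(h_ε)_{ε ∈ (0,1]}` is a regularisation of the distribution `S`. -/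
def IsRegularisation {d : ℕ} {F : Type} [NormedAddCommGroup F] [NormedSpace ℝ F]
    (S : 𝓓'((⊤ : TopologicalSpace.Opens (Space d)), F)) (h : ℝ → Space d → F) : Prop :=
  ∃ ψ, IsMollifier ψ ∧ ∀ ε, ∀ hε : ε ∈ Ioc (0 : ℝ) 1, ∀ x, h ε x = mollify S ψ ε hε.1 x

/-- The net `(h_ε(t,·))_{ε ∈ (0,1]}` is a regularisation of the distribution `S t` in the space
variable, for every `t ∈ [0,T]`, by one mollifying net. -/
def IsRegularisationOn {d : ℕ} {F : Type} [NormedAddCommGroup F] [NormedSpace ℝ F] (T : ℝ)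
    (S : ℝ → 𝓓'((⊤ : TopologicalSpace.Opens (Space d)), F)) (h : ℝ → ℝ → Space d → F) : Prop :=
  ∃ ψ, IsMollifier ψ ∧ ∀ ε, ∀ hε : ε ∈ Ioc (0 : ℝ) 1, ∀ t ∈ Icc 0 T, ∀ x,
    h ε t x = mollify (S t) ψ ε hε.1 x

/-! ### Moderateness -/

/-- `(h_ε)` is an `L^p(ℝ^d)`-moderate net. -/
def LpModerate {d : ℕ} {F : Type} [NormedAddCommGroup F] (p : ℝ≥0∞) (h : ℝ → Space d → F) :
    Prop :=
  ∃ N : ℕ, 0 < N ∧ ∃ C : ℝ, 0 < C ∧ ∀ ε ∈ Ioc (0 : ℝ) 1,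
    MemLp (h ε) p volume ∧ eLpNorm (h ε) p volume ≤ ENNReal.ofReal (C / ε ^ N)

/-- `(h_ε)` is an `L²(ℝ^d)`-moderate net of sources: `h_ε ∈ C([0,T]; L²(ℝ^d))` and the bound is
uniform in `t ∈ [0,T]`. -/
def SourceModerate {d : ℕ} (T : ℝ) (h : ℝ → ℝ → Space d → ℂ) : Prop :=
  ∃ N : ℕ, 0 < N ∧ ∃ C : ℝ, 0 < C ∧ ∀ ε ∈ Ioc (0 : ℝ) 1, ∀ t ∈ Icc 0 T,
    MemLp (h ε t) 2 volume ∧ eLpNorm (h ε t) 2 volume ≤ ENNReal.ofReal (C / ε ^ N) ∧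
    Tendsto (fun τ => eLpNorm (h ε τ - h ε t) 2 volume) (𝓝[Icc 0 T] t) (𝓝 0)

/-- `(h_ε)` is an `H^s(ℝ^d)`-moderate net. -/
def HsModerate {d : ℕ} (s : ℝ) (h : ℝ → Space d → ℂ) : Prop :=
  ∃ N : ℕ, 0 < N ∧ ∃ C : ℝ, 0 < C ∧ ∀ ε ∈ Ioc (0 : ℝ) 1,
    ∃ v : L2 d, v =ᵐ[volume] h ε ∧ hsENorm s v ≤ ENNReal.ofReal (C / ε ^ N)

/-- `(u_ε)` is a `C([0,T]; H^s) ∩ C¹([0,T]; L²)`-moderate net. -/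
def C1Moderate {d : ℕ} (s T : ℝ) (u : ℝ → ℝ → L2 d) : Prop :=
  (∀ ε ∈ Ioc (0 : ℝ) 1, MemC1 s T (u ε)) ∧
  ∃ N : ℕ, 0 < N ∧ ∃ C : ℝ, 0 < C ∧ ∀ ε ∈ Ioc (0 : ℝ) 1, ∀ t ∈ Icc 0 T,
    norm1 s T (u ε) t ≤ C / ε ^ N

/-! ### Very weak solutions -/

/-- The nets `gε, mε, bε, fε, u₀ε, u₁ε` are moderate regularisations of `g, m, b, f, u₀, u₁` in
`L^∞, L^∞, L^∞, L², H^s, L²`, with `g_ε > 0`, `m_ε ≥ 0` and `b_ε ≥ 0`. -/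
structure ModerateRegularisations {d : ℕ} (s T : ℝ)
    (g m b : 𝓓'((⊤ : TopologicalSpace.Opens (Space d)), ℝ))
    (f : ℝ → 𝓓'((⊤ : TopologicalSpace.Opens (Space d)), ℂ))
    (u₀ u₁ : 𝓓'((⊤ : TopologicalSpace.Opens (Space d)), ℂ))
    (gε mε bε : ℝ → Space d → ℝ) (fε : ℝ → ℝ → Space d → ℂ) (u₀ε u₁ε : ℝ → Space d → ℂ) :
    Prop where
  reg_g : IsRegularisation g gε
  reg_m : IsRegularisation m mε
  reg_b : IsRegularisation b bε
  reg_f : IsRegularisationOn T f fε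
  reg_u₀ : IsRegularisation u₀ u₀ε
  reg_u₁ : IsRegularisation u₁ u₁ε
  moderate_g : LpModerate ∞ gε
  moderate_m : LpModerate ∞ mε
  moderate_b : LpModerate ∞ bε
  moderate_f : SourceModerate T fε
  moderate_u₀ : HsModerate s u₀ε
  moderate_u₁ : LpModerate 2 u₁ε
  pos_g : ∀ ε ∈ Ioc (0 : ℝ) 1, ∀ x, 0 < gε ε x
  nonneg_m : ∀ ε ∈ Ioc (0 : ℝ) 1, ∀ x, 0 ≤ mε ε x
  nonneg_b : ∀ ε ∈ Ioc (0 : ℝ) 1, ∀ x, 0 ≤ bε ε x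

/-- The net `u = (u_ε)_{ε ∈ (0,1]}` solves the Cauchy problems whose coefficients, source and data
are the members of the given nets. -/
def SolvesRegularised {d : ℕ} (s T : ℝ)
    (gε mε bε : ℝ → Space d → ℝ) (fε : ℝ → ℝ → Space d → ℂ) (u₀ε u₁ε : ℝ → Space d → ℂ)
    (u : ℝ → ℝ → L2 d) : Prop :=
  ∀ ε ∈ Ioc (0 : ℝ) 1, IsSolution s T (gε ε) (mε ε) (bε ε) (fε ε) (u₀ε ε) (u₁ε ε) (u ε)

/-- The net `u` is a very weak solution of `u_tt + D_g^s u + m u + b u_t = f`, `u(0) = u₀`,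
`u_t(0) = u₁`. -/
def IsVeryWeakSolution {d : ℕ} (s T : ℝ)
    (g m b : 𝓓'((⊤ : TopologicalSpace.Opens (Space d)), ℝ))
    (f : ℝ → 𝓓'((⊤ : TopologicalSpace.Opens (Space d)), ℂ))
    (u₀ u₁ : 𝓓'((⊤ : TopologicalSpace.Opens (Space d)), ℂ)) (u : ℝ → ℝ → L2 d) : Prop :=
  ∃ (gε mε bε : ℝ → Space d → ℝ) (fε : ℝ → ℝ → Space d → ℂ) (u₀ε u₁ε : ℝ → Space d → ℂ),
    ModerateRegularisations s T g m b f u₀ u₁ gε mε bε fε u₀ε u₁ε ∧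
    SolvesRegularised s T gε mε bε fε u₀ε u₁ε u ∧ C1Moderate s T u

end VeryWeak

/-!
The theorem is an existence statement for each fixed `ε`, with a bound that is polynomial in the
norms of the coefficients and the data; the latter forbids treating `m` and `b` as bounded
perturbations, which would put `exp (T ‖b‖)` into the estimate.

For fixed coefficients write `Λ = (-Δ)^{s/2}` and pass to the state `(p, q, r) =
(u_t, g^{1/2} Λ u, m^{1/2} u)` in `L² × L² × L²`, whose norm is the energy. The equation becomes
`U' = A U + (f, 0, 0)` with `A (p, q, r) = (-Λ g^{1/2} q - m^{1/2} r - b p, g^{1/2} Λ p, m^{1/2} p)`.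
Since `Λ` is self-adjoint and `b ≥ 0`, `Re ⟨U, A U⟩ = -⟨b p, p⟩ ≤ 0`; the closed operator `A` is
maximal dissipative because the orthogonal complement of the range of `1 - l A` is trivial
(`isMaximalDissipative_waveGraph`). Here `g ≥ c > 0` makes `g^{1/2}` invertible.

For a maximal dissipative `A`, the equation is solved with the bounded dissipative Yosida
approximations in place of `A`. Their solutions are uniformly Cauchy: after smoothing by two
resolvents they differ by little, as the resolvents commute with everything, and the smoothing
costs little on the compact set of the data. The limit is a mild solution with
`‖U t‖ ≤ ‖U 0‖ + T sup ‖f‖` (`exists_mildSolution`). The function `u = u₀ + ∫ p` then has the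
required regularity and satisfies the weak equation (`exists_wave`, `exists_isSolution`), and
`Λ u = g^{-1/2} q` is bounded by `c^{-1/2}` times the energy norm. With moderate coefficients and
data, and `c` replaced by `c ε^N`, all these bounds are polynomial in `1/ε`.
-/

namespace VeryWeak

/-! ### Evolution equations with a bounded dissipative operator -/

section Evolution

variable {E : Type*} [NormedAddCommGroup E] [InnerProductSpace ℂ E]

theorem hasDerivAt_clm_comp {F : Type*} [NormedAddCommGroup F] [NormedSpace ℂ F]
    (L : E →L[ℂ] F) {U : ℝ → E} {U' : E} {t : ℝ}
    (h : HasDerivAt U U' t) : HasDerivAt (fun τ => L (U τ)) (L U') t :=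
  (L.restrictScalars ℝ).hasFDerivAt.comp_hasDerivAt t h

theorem intervalIntegral_clm_comp [CompleteSpace E] {F : Type*} [NormedAddCommGroup F]
    [NormedSpace ℂ F] [CompleteSpace F] (L : E →L[ℂ] F) {U : ℝ → E} (hU : Continuous U) (t : ℝ) :
    ∫ τ in (0 : ℝ)..t, L (U τ) = L (∫ τ in (0 : ℝ)..t, U τ) :=
  L.intervalIntegral_comp_comm (hU.intervalIntegrable 0 t)

variable [CompleteSpace E]

theorem hasDerivAt_exp_smul_apply (L : E →L[ℂ] E) {c : ℝ → ℝ} {c' : ℝ} {U : ℝ → E} {U' : E}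
    {t : ℝ} (hc : HasDerivAt c c' t) (hU : HasDerivAt U U' t) :
    HasDerivAt (fun τ => NormedSpace.exp (c τ • L) (U τ))
      (c' • L (NormedSpace.exp (c t • L) (U t)) + NormedSpace.exp (c t • L) U') t := by
  have h1 : HasDerivAt (fun τ => NormedSpace.exp (c τ • L))
      (c' • (L * NormedSpace.exp (c t • L))) t :=
    (hasDerivAt_exp_smul_const' (𝕂 := ℝ) L (c t)).scomp t hc
  have h2 : HasDerivAt (fun τ => (NormedSpace.exp (c τ • L)).restrictScalars ℝ)
      ((c' • (L * NormedSpace.exp (c t • L))).restrictScalars ℝ) t :=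
    (ContinuousLinearMap.restrictScalarsL ℂ E E ℝ ℝ).hasFDerivAt.comp_hasDerivAt t h1
  exact h2.clm_apply hU

/-- A bounded dissipative operator generates a semigroup of contractions. -/
theorem norm_exp_smul_apply_le {L : E →L[ℂ] E} (hL : ∀ x, (inner ℂ x (L x)).re ≤ 0) {t : ℝ}
    (ht : 0 ≤ t) (x : E) : ‖NormedSpace.exp (t • L) x‖ ≤ ‖x‖ := by
  have hd : ∀ τ : ℝ, HasDerivAt (fun τ : ℝ => NormedSpace.exp (τ • L) x)
      (L (NormedSpace.exp (τ • L) x)) τ := fun τ =>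
    (hasDerivAt_exp_smul_apply L (hasDerivAt_id τ) (hasDerivAt_const τ x)).congr_deriv (by simp)
  have hn : ∀ τ : ℝ, HasDerivAt (fun τ : ℝ => ‖NormedSpace.exp (τ • L) x‖ ^ 2)
      (2 * (inner ℂ (NormedSpace.exp (τ • L) x) (L (NormedSpace.exp (τ • L) x))).re) τ := by
    intro τ
    have h := ((hd τ).inner ℂ (hd τ))
    have h' := Complex.reCLM.hasFDerivAt.comp_hasDerivAt τ h
    refine (h'.congr_deriv ?_).congr_of_eventuallyEq (Eventually.of_forall fun σ => ?_)
    · rw [two_mul, Complex.reCLM_apply, Complex.add_re]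
      congr 1
      exact inner_re_symm (𝕜 := ℂ) _ _
    · exact (inner_self_eq_norm_sq (𝕜 := ℂ) _).symm
  have hanti : Antitone fun τ : ℝ => ‖NormedSpace.exp (τ • L) x‖ ^ 2 :=
    antitone_of_deriv_nonpos (fun τ => (hn τ).differentiableAt) fun τ => by
      rw [(hn τ).deriv]
      linarith [hL (NormedSpace.exp (τ • L) x)]
  have h := hanti ht
  simp only [zero_smul, NormedSpace.exp_zero, one_apply_eq_self] at h
  exact (sq_le_sq₀ (norm_nonneg _) (norm_nonneg _)).1 h

/-- The energy estimate for `U' = L U + F` with `L` bounded and dissipative. -/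
theorem norm_le_of_hasDerivAt_of_dissipative {L : E →L[ℂ] E}
    (hL : ∀ x, (inner ℂ x (L x)).re ≤ 0)
    {U F : ℝ → E} (hU : ∀ t, HasDerivAt U (L (U t) + F t) t) {K t : ℝ} (ht : 0 ≤ t)
    (hF : ∀ τ ∈ Icc 0 t, ‖F τ‖ ≤ K) : ‖U t‖ ≤ ‖U 0‖ + t * K := by
  -- interpolate between `exp (t L) (U 0)` and `U t`
  have hV : ∀ τ : ℝ, HasDerivAt (fun τ : ℝ => NormedSpace.exp ((t - τ) • L) (U τ))
      (NormedSpace.exp ((t - τ) • L) (F τ)) τ := by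
    intro τ
    refine (hasDerivAt_exp_smul_apply L ((hasDerivAt_id τ).const_sub t) (hU τ)).congr_deriv ?_
    have hc : L (NormedSpace.exp ((t - τ) • L) (U τ)) = NormedSpace.exp ((t - τ) • L) (L (U τ)) :=
      DFunLike.congr_fun
        (((Commute.refl L).smul_right (t - τ)).exp_right : Commute L _).eq (U τ)
    simp [hc]
  have h := norm_image_sub_le_of_norm_deriv_le_segment' (a := 0) (b := t) (C := K)
    (fun τ _ => (hV τ).hasDerivWithinAt)
    (fun τ hτ => (norm_exp_smul_apply_le hL (sub_nonneg.2 hτ.2.le) _).trans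
      (hF τ (Ico_subset_Icc_self hτ))) t (right_mem_Icc.2 ht)
  have h0 := norm_exp_smul_apply_le hL ht (U 0)
  simp only [sub_self, zero_smul, NormedSpace.exp_zero, one_apply_eq_self,
    sub_zero] at h
  have := norm_sub_norm_le (U t) (NormedSpace.exp (t • L) (U 0))
  linarith

/-- The solution is given by Duhamel's formula. -/
theorem exists_hasDerivAt_of_bounded (L : E →L[ℂ] E) {F : ℝ → E} (hF : Continuous F) (x₀ : E) :
    ∃ U : ℝ → E, U 0 = x₀ ∧ ∀ t, HasDerivAt U (L (U t) + F t) t := by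
  have hG : Continuous fun τ : ℝ => NormedSpace.exp ((-τ) • L) (F τ) := by
    have : Continuous fun τ : ℝ => NormedSpace.exp ((-τ) • L) :=
      (differentiable_exp_smul_const ℝ L).continuous.comp continuous_neg
    exact this.clm_apply hF
  refine ⟨fun t => NormedSpace.exp (t • L)
    (x₀ + ∫ τ in (0 : ℝ)..t, NormedSpace.exp ((-τ) • L) (F τ)), by simp, fun t => ?_⟩
  have hI := (hG.integral_hasStrictDerivAt 0 t).hasDerivAt.const_add x₀
  refine (hasDerivAt_exp_smul_apply L (hasDerivAt_id t) hI).congr_deriv ?_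
  have hc : NormedSpace.exp (t • L) * NormedSpace.exp ((-t) • L) = 1 := by
    let := NormedAlgebra.restrictScalars ℚ ℝ (E →L[ℂ] E)
    rw [neg_smul, ← NormedSpace.exp_add_of_commute (Commute.neg_right (Commute.refl _)),
      add_neg_cancel, NormedSpace.exp_zero]
  have hc' := DFunLike.congr_fun hc (F t)
  simp only [id, one_smul]
  congr 1

end Evolution

/-! ### Maximal dissipative operators and their resolvents -/

section Dissipative

variable {E : Type*} [NormedAddCommGroup E] [InnerProductSpace ℂ E]

/-- A linear operator in `E`, given by its graph `A`, is maximal dissipative if it is closed,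
`Re ⟨x, A x⟩ ≤ 0` on its domain, and `1 - l A` is onto for every `l > 0`. Working with the graph
as a submodule of `E × E` makes single-valuedness a condition of its own. -/
structure IsMaximalDissipative (A : Submodule ℂ (E × E)) : Prop where
  eq_zero_of_mem : ∀ y, ((0 : E), y) ∈ A → y = 0
  isClosed : IsClosed (A : Set (E × E))
  dissipative : ∀ p ∈ A, (inner ℂ p.1 p.2).re ≤ 0
  surjective : ∀ l : ℝ, 0 < l → ∀ z, ∃ p ∈ A, p.1 - l • p.2 = z

theorem re_inner_real_smul_right (l : ℝ) (x y : E) :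
    (inner ℂ x (l • y)).re = l * (inner ℂ x y).re := by
  rw [inner_smul_right_eq_smul]
  simp

/-- `‖x‖ ≤ ‖x - l y‖` and `l ‖y‖ ≤ ‖x - l y‖` whenever `Re ⟨x, y⟩ ≤ 0`. -/
theorem norm_sq_add_norm_sq_le {x y : E} {l : ℝ} (hl : 0 ≤ l) (h : (inner ℂ x y).re ≤ 0) :
    ‖x‖ ^ 2 + (l * ‖y‖) ^ 2 ≤ ‖x - l • y‖ ^ 2 := by
  have h1 := norm_sub_sq (𝕜 := ℂ) x (l • y)
  have h2 := re_inner_real_smul_right l x y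
  rw [RCLike.re_to_complex] at h1
  rw [h1, h2, norm_smul, Real.norm_of_nonneg hl]
  nlinarith

theorem norm_le_norm_sub {x y : E} {l : ℝ} (hl : 0 ≤ l) (h : (inner ℂ x y).re ≤ 0) :
    ‖x‖ ≤ ‖x - l • y‖ :=
  (sq_le_sq₀ (norm_nonneg _) (norm_nonneg _)).1
    (by nlinarith [norm_sq_add_norm_sq_le hl h, sq_nonneg (l * ‖y‖)])

theorem mul_norm_le_norm_sub {x y : E} {l : ℝ} (hl : 0 ≤ l) (h : (inner ℂ x y).re ≤ 0) :
    l * ‖y‖ ≤ ‖x - l • y‖ :=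
  (sq_le_sq₀ (by positivity) (norm_nonneg _)).1
    (by nlinarith [norm_sq_add_norm_sq_le hl h, sq_nonneg ‖x‖])

/-- For a closed dissipative operator `A`, the range of `1 - l A` is closed, so that it is the whole
space as soon as its orthogonal complement is trivial. -/
theorem isMaximalDissipative_of_orthogonal [CompleteSpace E] {A : Submodule ℂ (E × E)}
    (h0 : ∀ y, ((0 : E), y) ∈ A → y = 0) (hc : IsClosed (A : Set (E × E)))
    (hd : ∀ p ∈ A, (inner ℂ p.1 p.2).re ≤ 0)
    (ho : ∀ l : ℝ, 0 < l → ∀ z, (∀ p ∈ A, inner ℂ (p.1 - l • p.2) z = 0) → z = 0) :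
    IsMaximalDissipative A := by
  refine ⟨h0, hc, hd, fun l hl => ?_⟩
  let S : A →L[ℂ] E := (ContinuousLinearMap.fst ℂ E E - (l : ℂ) • ContinuousLinearMap.snd ℂ E E) ∘L
    A.subtypeL
  have hS : ∀ p : A, S p = p.1.1 - l • p.1.2 := fun p => by simp [S]
  have hanti : AntilipschitzWith (max 1 (Real.toNNReal l⁻¹)) S := by
    refine ContinuousLinearMap.antilipschitz_of_bound S fun p => ?_
    have h1 := norm_le_norm_sub hl.le (hd p.1 p.2)
    have h2 := mul_norm_le_norm_sub hl.le (hd p.1 p.2)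
    rw [← hS] at h1 h2
    rw [NNReal.coe_max, Real.coe_toNNReal _ (inv_nonneg.2 hl.le), NNReal.coe_one,
      Submodule.coe_norm, Prod.norm_def]
    refine max_le (h1.trans ?_) ?_
    · nlinarith [le_max_left 1 l⁻¹, norm_nonneg (S p)]
    · have h3 : ‖p.1.2‖ ≤ l⁻¹ * ‖S p‖ := by
        rw [inv_mul_eq_div, le_div_iff₀ hl]; linarith
      exact h3.trans (by gcongr; exact le_max_right _ _)
  have : CompleteSpace A := hc.completeSpace_coe
  have hcl : IsClosed (S.range : Set E) := by
    have := hanti.isClosed_range S.uniformContinuous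
    rwa [LinearMap.coe_range]
  have : CompleteSpace S.range := hcl.completeSpace_coe
  have htop : S.range = ⊤ := by
    rw [← Submodule.orthogonal_eq_bot_iff, Submodule.eq_bot_iff]
    intro z hz
    refine ho l hl z fun p hp => ?_
    rw [← hS ⟨p, hp⟩]
    exact (Submodule.mem_orthogonal _ z).1 hz _ ⟨⟨p, hp⟩, rfl⟩
  intro z
  obtain ⟨p, hp⟩ : z ∈ S.range := htop ▸ Submodule.mem_top
  exact ⟨p.1, p.2, by rw [← hS]; exact hp⟩

/-- `J l = (1 - l A)⁻¹` for every `l > 0`: the vector `x = J l z` lies in the domain of `A`, with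
`A x = l⁻¹ (x - z)`. The values at `l ≤ 0` are irrelevant. -/
def IsResolventFamily (A : Submodule ℂ (E × E)) (J : ℝ → E →L[ℂ] E) : Prop :=
  ∀ l : ℝ, 0 < l → ∀ z, (J l z, l⁻¹ • (J l z - z)) ∈ A

/-- A dissipative operator has no positive eigenvalue. -/
theorem eq_zero_of_mem_smul {A : Submodule ℂ (E × E)} (hA : IsMaximalDissipative A) {l : ℝ}
    (hl : 0 < l) {x : E} (hx : (x, l⁻¹ • x) ∈ A) : x = 0 := by
  have h := hA.dissipative _ hx
  rw [re_inner_real_smul_right] at h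
  have h' : (inner ℂ x x).re = ‖x‖ ^ 2 := inner_self_eq_norm_sq (𝕜 := ℂ) x
  rw [h'] at h
  have : ‖x‖ ^ 2 = 0 :=
    le_antisymm (nonpos_of_mul_nonpos_right h (inv_pos.2 hl)) (sq_nonneg _)
  simpa using this

/-- The equation `x - l A x = z` has at most one solution. -/
theorem resolvent_unique {A : Submodule ℂ (E × E)} (hA : IsMaximalDissipative A) {l : ℝ}
    (hl : 0 < l) {x y z : E} (hx : (x, l⁻¹ • (x - z)) ∈ A) (hy : (y, l⁻¹ • (y - z)) ∈ A) :
    x = y := by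
  refine sub_eq_zero.1 (eq_zero_of_mem_smul hA hl ?_)
  have := A.sub_mem hx hy
  rwa [Prod.mk_sub_mk, ← smul_sub, sub_sub_sub_cancel_right] at this

theorem exists_isResolventFamily {A : Submodule ℂ (E × E)} (hA : IsMaximalDissipative A) :
    ∃ J, IsResolventFamily A J := by
  suffices ∀ l : ℝ, 0 < l → ∃ J : E →L[ℂ] E, ∀ z, (J z, l⁻¹ • (J z - z)) ∈ A by
    choose J hJ using this
    classical
    refine ⟨fun l => if hl : 0 < l then J l hl else 0, fun l hl z => ?_⟩
    simp only [hl, dif_pos]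
    exact hJ l hl z
  intro l hl
  choose p hpA hp using hA.surjective l hl
  have hmem : ∀ z, ((p z).1, l⁻¹ • ((p z).1 - z)) ∈ A := fun z => by
    have h : l⁻¹ • ((p z).1 - z) = (p z).2 := by
      nth_rw 2 [← hp z]
      rw [sub_sub_cancel, inv_smul_smul₀ hl.ne']
    rw [h]
    exact hpA z
  let J : E →ₗ[ℂ] E :=
    { toFun := fun z => (p z).1
      map_add' := fun x y => by
        refine resolvent_unique hA hl (hmem _) ?_
        have := A.add_mem (hmem x) (hmem y)
        rwa [Prod.mk_add_mk, ← smul_add, sub_add_sub_comm] at this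
      map_smul' := fun c x => by
        refine resolvent_unique hA hl (hmem _) ?_
        have := A.smul_mem c (hmem x)
        rwa [Prod.smul_mk, smul_comm, smul_sub] at this }
  refine ⟨J.mkContinuous 1 fun z => ?_, hmem⟩
  rw [one_mul]
  have := norm_le_norm_sub hl.le (hA.dissipative _ (hpA z))
  rwa [hp z] at this

/-- The Yosida approximation `l⁻¹ (J l - 1) = A J l` of `A`, a bounded operator. -/
noncomputable def yosida (J : ℝ → E →L[ℂ] E) (l : ℝ) : E →L[ℂ] E :=
  (l⁻¹ : ℝ) • (J l - 1)

theorem yosida_apply (J : ℝ → E →L[ℂ] E) (l : ℝ) (z : E) : yosida J l z = l⁻¹ • (J l z - z) := rfl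

theorem resolvent_sub_self (J : ℝ → E →L[ℂ] E) {l : ℝ} (hl : 0 < l) (z : E) :
    J l z - z = l • yosida J l z := by
  rw [yosida_apply, smul_inv_smul₀ hl.ne']

section Resolvent

variable {A : Submodule ℂ (E × E)} {J : ℝ → E →L[ℂ] E}

theorem IsResolventFamily.mem (hJ : IsResolventFamily A J) {l : ℝ} (hl : 0 < l) (z : E) :
    (J l z, yosida J l z) ∈ A := hJ l hl z

theorem IsResolventFamily.norm_le (hJ : IsResolventFamily A J) (hA : IsMaximalDissipative A)
    {l : ℝ} (hl : 0 < l) (z : E) : ‖J l z‖ ≤ ‖z‖ := by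
  have h := norm_le_norm_sub hl.le (hA.dissipative _ (hJ.mem hl z))
  simpa [← resolvent_sub_self J hl z] using h

theorem IsResolventFamily.yosida_dissipative (hJ : IsResolventFamily A J)
    (hA : IsMaximalDissipative A) {l : ℝ} (hl : 0 < l) (z : E) :
    (inner ℂ z (yosida J l z)).re ≤ 0 := by
  have hz : z = J l z - l • yosida J l z := by rw [← resolvent_sub_self J hl, sub_sub_cancel]
  have h1 := hA.dissipative _ (hJ.mem hl z)
  have h2 : (inner ℂ (l • yosida J l z) (yosida J l z)).re = l * ‖yosida J l z‖ ^ 2 := by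
    rw [inner_smul_left_eq_smul]
    have : (inner ℂ (yosida J l z) (yosida J l z)).re = ‖yosida J l z‖ ^ 2 :=
      inner_self_eq_norm_sq (𝕜 := ℂ) _
    rw [Complex.smul_re, smul_eq_mul, this]
  rw [show inner ℂ z (yosida J l z) = inner ℂ (J l z - l • yosida J l z) (yosida J l z) by rw [← hz],
    inner_sub_left, Complex.sub_re, h2]
  have : 0 ≤ l * ‖yosida J l z‖ ^ 2 := by positivity
  simp only at h1
  linarith

/-- On the domain of `A`, the Yosida approximation is `J l A`. -/
theorem IsResolventFamily.yosida_eq (hJ : IsResolventFamily A J) (hA : IsMaximalDissipative A)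
    {l : ℝ} (hl : 0 < l) {p : E × E} (hp : p ∈ A) : yosida J l p.1 = J l p.2 := by
  have h : J l (p.1 - l • p.2) = p.1 := by
    refine resolvent_unique hA hl (hJ l hl _) ?_
    rwa [sub_sub_cancel, inv_smul_smul₀ hl.ne']
  have h' : J l p.1 - p.1 = l • J l p.2 := by
    rw [map_sub, ContinuousLinearMap.map_smul_of_tower] at h
    nth_rw 2 [← h]
    abel
  rw [yosida_apply, h', inv_smul_smul₀ hl.ne']

theorem IsResolventFamily.map_mem (hJ : IsResolventFamily A J) (hA : IsMaximalDissipative A)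
    {l : ℝ} (hl : 0 < l) {p : E × E} (hp : p ∈ A) : (J l p.1, J l p.2) ∈ A := by
  rw [← hJ.yosida_eq hA hl hp]
  exact hJ.mem hl _

theorem IsResolventFamily.comm (hJ : IsResolventFamily A J) (hA : IsMaximalDissipative A)
    {l k : ℝ} (hl : 0 < l) (hk : 0 < k) (z : E) : J l (J k z) = J k (J l z) := by
  refine resolvent_unique hA hl (hJ l hl _) ?_
  have := hJ.map_mem hA hk (hJ l hl z)
  simpa only [ContinuousLinearMap.map_smul_of_tower, map_sub] using this

theorem IsResolventFamily.yosida_comm (hJ : IsResolventFamily A J) (hA : IsMaximalDissipative A)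
    {l k : ℝ} (hl : 0 < l) (hk : 0 < k) (z : E) : yosida J l (J k z) = J k (yosida J l z) := by
  simp only [yosida_apply, ContinuousLinearMap.map_smul_of_tower, map_sub, hJ.comm hA hl hk]

/-- On vectors smoothed by `J k` twice, the Yosida approximations converge with a rate. -/
theorem IsResolventFamily.norm_yosida_sub_le (hJ : IsResolventFamily A J)
    (hA : IsMaximalDissipative A) {l l' k : ℝ} (hl : 0 < l) (hl' : 0 < l') (hk : 0 < k) (z : E) :
    ‖yosida J l (J k (J k z)) - yosida J l' (J k (J k z))‖
      ≤ (l + l') * (‖yosida J k‖ ^ 2 * ‖z‖) := by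
  have key : ∀ {m : ℝ}, 0 < m → ∃ w, ‖w‖ ≤ ‖yosida J k‖ ^ 2 * ‖z‖ ∧
      yosida J m (J k (J k z)) = J k (yosida J k z) + m • w := by
    intro m hm
    refine ⟨J m (yosida J k (yosida J k z)), ?_, ?_⟩
    · refine (hJ.norm_le hA hm _).trans (((yosida J k).le_opNorm _).trans ?_)
      rw [pow_two, mul_assoc]
      gcongr
      exact (yosida J k).le_opNorm _
    · rw [hJ.yosida_eq hA hm (hJ.mem hk (J k z)), hJ.yosida_comm hA hk hk]
      rw [← hJ.yosida_eq hA hm (hJ.mem hk (yosida J k z)), ← resolvent_sub_self J hm]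
      abel
  obtain ⟨w, hw, h1⟩ := key hl
  obtain ⟨w', hw', h2⟩ := key hl'
  rw [h1, h2, add_sub_add_left_eq_sub, add_mul]
  refine (norm_sub_le _ _).trans (add_le_add ?_ ?_) <;> rw [norm_smul, Real.norm_of_nonneg] <;>
    gcongr

/-- The domain of a maximal dissipative operator is dense. -/
theorem IsMaximalDissipative.dense_domain [CompleteSpace E] (hA : IsMaximalDissipative A) :
    Dense ((A.map (LinearMap.fst ℂ E E) : Submodule ℂ E) : Set E) := by
  rw [Submodule.dense_iff_topologicalClosure_eq_top, Submodule.topologicalClosure_eq_top_iff,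
    Submodule.eq_bot_iff]
  intro z hz
  obtain ⟨p, hp, hpz⟩ := hA.surjective 1 one_pos z
  have h0 : inner ℂ p.1 z = 0 :=
    (Submodule.mem_orthogonal _ z).1 hz _ (Submodule.mem_map.2 ⟨p, hp, rfl⟩)
  have hd := hA.dissipative p hp
  have hz' : z = p.1 - p.2 := by rw [← hpz, one_smul]
  rw [hz', inner_sub_right, sub_eq_zero] at h0
  have h' : (inner ℂ p.1 p.1).re = ‖p.1‖ ^ 2 := inner_self_eq_norm_sq (𝕜 := ℂ) p.1
  rw [← h0, h'] at hd
  have hp1 : p.1 = 0 := by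
    have : ‖p.1‖ ^ 2 = 0 := le_antisymm hd (sq_nonneg _)
    simpa using this
  have h2 : p.2 = 0 := hA.eq_zero_of_mem _ (by rwa [← hp1])
  rw [hz', hp1, h2, sub_zero]

end Resolvent
end Dissipative

/-! ### Mild solutions of the inhomogeneous equation -/

section MildSolution

variable {E : Type*} [NormedAddCommGroup E] [InnerProductSpace ℂ E] [CompleteSpace E]
  {A : Submodule ℂ (E × E)} {J : ℝ → E →L[ℂ] E}

theorem IsResolventFamily.tendsto (hJ : IsResolventFamily A J) (hA : IsMaximalDissipative A)
    (z : E) : Tendsto (fun l => J l z) (𝓝[>] 0) (𝓝 z) := by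
  rw [Metric.tendsto_nhds]
  intro e he
  obtain ⟨x, hx, hxz⟩ := Metric.dense_iff.1 hA.dense_domain z (e / 3) (by positivity)
  obtain ⟨p, hp, rfl⟩ := Submodule.mem_map.1 hxz
  rw [LinearMap.fst_apply] at hx
  have hsmall : ∀ᶠ l : ℝ in 𝓝[>] 0, l * ‖p.2‖ < e / 3 := by
    have : Tendsto (fun l : ℝ => l * ‖p.2‖) (𝓝[>] 0) (𝓝 (0 * ‖p.2‖)) :=
      ((continuous_id.mul continuous_const).tendsto 0).mono_left nhdsWithin_le_nhds
    rw [zero_mul] at this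
    exact this.eventually_lt_const (by positivity)
  filter_upwards [hsmall, self_mem_nhdsWithin] with l hl hpos
  have hpos : 0 < l := hpos
  have h1 : dist (J l z) (J l p.1) ≤ dist z p.1 := by
    rw [dist_eq_norm, dist_eq_norm, ← map_sub]
    exact hJ.norm_le hA hpos _
  have h2 : dist (J l p.1) p.1 ≤ l * ‖p.2‖ := by
    rw [dist_eq_norm, resolvent_sub_self J hpos, hJ.yosida_eq hA hpos hp, norm_smul,
      Real.norm_of_nonneg hpos.le]
    gcongr
    exact hJ.norm_le hA hpos _
  rw [Metric.mem_ball, dist_comm] at hx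
  linarith [dist_triangle4 (J l z) (J l p.1) p.1 z, dist_comm p.1 z]

/-- The resolvents converge to the identity uniformly on compact sets. -/
theorem IsResolventFamily.eventually_norm_sub_le (hJ : IsResolventFamily A J)
    (hA : IsMaximalDissipative A) {S : Set E} (hS : IsCompact S) {e : ℝ} (he : 0 < e) :
    ∀ᶠ l in 𝓝[>] 0, ∀ z ∈ S, ‖J l z - z‖ ≤ e := by
  refine hS.induction_on (p := fun S => ∀ᶠ l in 𝓝[>] 0, ∀ z ∈ S, ‖J l z - z‖ ≤ e)
    (by simp) (fun s t hst h => h.mono fun l hl z hz => hl z (hst hz))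
    (fun s t h h' => ?_) fun x _ => ?_
  · filter_upwards [h, h'] with l hl hl' z hz
    exact hz.elim (hl z) (hl' z)
  · refine ⟨Metric.ball x (e / 3), mem_nhdsWithin_of_mem_nhds
      (Metric.ball_mem_nhds x (by positivity)), ?_⟩
    filter_upwards [Metric.tendsto_nhds.1 (hJ.tendsto hA x) (e / 3) (by positivity),
      self_mem_nhdsWithin] with l hl hpos z hz
    have h1 : dist (J l z) (J l x) ≤ dist z x := by
      rw [dist_eq_norm, dist_eq_norm, ← map_sub]
      exact hJ.norm_le hA hpos _
    rw [Metric.mem_ball] at hz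
    rw [← dist_eq_norm]
    linarith [dist_triangle4 (J l z) (J l x) x z, dist_comm x z]

/-- The solutions of the equations with `A` replaced by its Yosida approximations are uniformly
Cauchy on `[0,T]`. A smoothed difference `J k (J k (U - U'))` solves an equation whose source is
small with `l + l'`; what the smoothing discards solves an equation with small data. -/
theorem IsResolventFamily.norm_sub_le_of_hasDerivAt (hJ : IsResolventFamily A J)
    (hA : IsMaximalDissipative A) {l l' k : ℝ} (hl : 0 < l) (hl' : 0 < l') (hk : 0 < k)
    {U U' F : ℝ → E} {x₀ : E} (hU : ∀ t, HasDerivAt U (yosida J l (U t) + F t) t) (hU0 : U 0 = x₀)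
    (hU' : ∀ t, HasDerivAt U' (yosida J l' (U' t) + F t) t) (hU0' : U' 0 = x₀)
    {T K e t : ℝ} (hK : ∀ τ ∈ Icc 0 T, ‖F τ‖ ≤ K) (ht : t ∈ Icc 0 T) (he0 : ‖J k x₀ - x₀‖ ≤ e)
    (heF : ∀ τ ∈ Icc 0 T, ‖J k (F τ) - F τ‖ ≤ e) :
    ‖U t - U' t‖
      ≤ T * ((l + l') * (‖yosida J k‖ ^ 2 * (‖x₀‖ + T * K))) + 4 * (e + T * e) := by
  have hT : 0 ≤ T := ht.1.trans ht.2
  have hK0 : 0 ≤ K := (norm_nonneg _).trans (hK t ht)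
  have hle : ∀ {m : ℝ} {V : ℝ → E}, 0 < m → (∀ t, HasDerivAt V (yosida J m (V t) + F t) t) →
      V 0 = x₀ → ∀ τ ∈ Icc 0 T, ‖V τ‖ ≤ ‖x₀‖ + T * K := by
    intro m V hm hV hV0 τ hτ
    have := norm_le_of_hasDerivAt_of_dissipative (hJ.yosida_dissipative hA hm) hV hτ.1
      (fun σ hσ => hK σ ⟨hσ.1, hσ.2.trans hτ.2⟩)
    rw [hV0] at this
    refine this.trans ?_
    gcongr
    exact hτ.2
  have he : 0 ≤ e := (norm_nonneg _).trans he0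
  have hJJ : ∀ z, ‖J k z - z‖ ≤ e → ‖J k (J k z) - z‖ ≤ 2 * e := by
    intro z hz
    have h1 : J k (J k z) - z = J k (J k z - z) + (J k z - z) := by rw [map_sub]; abel
    rw [h1]
    linarith [norm_add_le (J k (J k z - z)) (J k z - z), hJ.norm_le hA hk (J k z - z)]
  -- the part which is discarded by the smoothing
  have hdisc : ∀ {m : ℝ} {V : ℝ → E}, 0 < m → (∀ t, HasDerivAt V (yosida J m (V t) + F t) t) →
      V 0 = x₀ → ‖J k (J k (V t)) - V t‖ ≤ 2 * (e + T * e) := by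
    intro m V hm hV hV0
    have hD : ∀ τ, HasDerivAt (fun τ => J k (J k (V τ)) - V τ)
        (yosida J m (J k (J k (V τ)) - V τ) + (J k (J k (F τ)) - F τ)) τ := by
      intro τ
      refine ((hasDerivAt_clm_comp (J k) (hasDerivAt_clm_comp (J k) (hV τ))).sub
        (hV τ)).congr_deriv ?_
      simp only [map_sub, map_add, hJ.yosida_comm hA hm hk]
      abel
    have := norm_le_of_hasDerivAt_of_dissipative (hJ.yosida_dissipative hA hm) hD ht.1
      (fun σ hσ => hJJ _ (heF σ ⟨hσ.1, hσ.2.trans ht.2⟩))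
    rw [hV0] at this
    have h0 := hJJ _ he0
    nlinarith [mul_le_mul_of_nonneg_right ht.2 he]
  have hsmooth : ‖J k (J k (U t)) - J k (J k (U' t))‖
      ≤ T * ((l + l') * (‖yosida J k‖ ^ 2 * (‖x₀‖ + T * K))) := by
    have hD : ∀ τ, HasDerivAt (fun τ => J k (J k (U τ)) - J k (J k (U' τ)))
        (yosida J l (J k (J k (U τ)) - J k (J k (U' τ)))
          + (yosida J l (J k (J k (U' τ))) - yosida J l' (J k (J k (U' τ))))) τ := by
      intro τ
      refine ((hasDerivAt_clm_comp (J k) (hasDerivAt_clm_comp (J k) (hU τ))).sub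
        (hasDerivAt_clm_comp (J k) (hasDerivAt_clm_comp (J k) (hU' τ)))).congr_deriv ?_
      simp only [map_sub, map_add, hJ.yosida_comm hA hl hk, hJ.yosida_comm hA hl' hk]
      abel
    have := norm_le_of_hasDerivAt_of_dissipative (hJ.yosida_dissipative hA hl) hD ht.1
      (fun σ hσ => (hJ.norm_yosida_sub_le hA hl hl' hk (U' σ)).trans
        (mul_le_mul_of_nonneg_left (mul_le_mul_of_nonneg_left
          (hle hl' hU' hU0' σ ⟨hσ.1, hσ.2.trans ht.2⟩) (by positivity)) (by positivity)))
    rw [hU0, hU0', sub_self, norm_zero, zero_add] at this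
    refine this.trans ?_
    gcongr
    exact ht.2
  have h1 := hdisc hl hU hU0
  have h2 := hdisc hl' hU' hU0'
  have h3 : U t - U' t = (J k (J k (U t)) - J k (J k (U' t))) - (J k (J k (U t)) - U t)
      + (J k (J k (U' t)) - U' t) := by abel
  rw [h3]
  linarith [norm_add_le ((J k (J k (U t)) - J k (J k (U' t))) - (J k (J k (U t)) - U t))
    (J k (J k (U' t)) - U' t),
    norm_sub_le (J k (J k (U t)) - J k (J k (U' t))) (J k (J k (U t)) - U t)]

/-- The inhomogeneous evolution equation `U' = A U + F`, `U(0) = x₀`, with `A` maximal dissipative,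
has a mild solution, and this solution obeys the energy estimate. -/
theorem exists_mildSolution (hA : IsMaximalDissipative A) {T : ℝ} (hT : 0 ≤ T) {F : ℝ → E}
    (hF : Continuous F) {K : ℝ} (hK : ∀ t ∈ Icc 0 T, ‖F t‖ ≤ K) (x₀ : E) :
    ∃ U : ℝ → E, Continuous U ∧ U 0 = x₀ ∧ ∀ t ∈ Icc 0 T, ‖U t‖ ≤ ‖x₀‖ + T * K ∧
      (∫ τ in (0 : ℝ)..t, U τ, U t - x₀ - ∫ τ in (0 : ℝ)..t, F τ) ∈ A := by
  obtain ⟨J, hJ⟩ := exists_isResolventFamily hA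
  let l : ℕ → ℝ := fun n => 1 / ((n : ℝ) + 1)
  have hl : ∀ n, 0 < l n := fun n => Nat.one_div_pos_of_nat
  have hl0 : Tendsto l atTop (𝓝 0) := tendsto_one_div_add_atTop_nhds_zero_nat
  have hl0' : Tendsto l atTop (𝓝[>] 0) :=
    tendsto_nhdsWithin_iff.2 ⟨hl0, Eventually.of_forall hl⟩
  choose V hV0 hV using fun n => exists_hasDerivAt_of_bounded (yosida J (l n)) hF x₀
  have hVc : ∀ n, Continuous (V n) := fun n =>
    continuous_iff_continuousAt.2 fun t => (hV n t).continuousAt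
  have hK0 : 0 ≤ K := (norm_nonneg _).trans (hK 0 ⟨le_rfl, hT⟩)
  -- given `e`, the smoothing parameter `k` is chosen first, and the index depends on `k`
  have hcauchy : UniformCauchySeqOn V atTop (Icc 0 T) := by
    rw [Metric.uniformCauchySeqOn_iff]
    intro e he
    have hS : IsCompact (insert x₀ (F '' Icc 0 T)) := (isCompact_Icc.image hF).insert x₀
    obtain ⟨k, hk, hkpos⟩ := ((hJ.eventually_norm_sub_le hA hS
      (show 0 < e / (8 * (1 + T)) by positivity)).and self_mem_nhdsWithin).exists
    have hkpos : 0 < k := hkpos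
    have hlim : Tendsto (fun n => T * (2 * l n * (‖yosida J k‖ ^ 2 * (‖x₀‖ + T * K)))) atTop
        (𝓝 (T * (2 * 0 * (‖yosida J k‖ ^ 2 * (‖x₀‖ + T * K))))) :=
      ((hl0.const_mul 2).mul_const _).const_mul T
    rw [mul_zero, zero_mul, mul_zero] at hlim
    obtain ⟨n₀, hn₀⟩ := (hlim.eventually_lt_const (show 0 < e / 2 by positivity)).exists
    refine ⟨n₀, fun n hn m hm t ht => ?_⟩
    have hmono : ∀ i, n₀ ≤ i → l i ≤ l n₀ := fun i hi => by
      simp only [l]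
      gcongr
    rw [dist_eq_norm]
    have h := hJ.norm_sub_le_of_hasDerivAt hA (hl n) (hl m) hkpos (hV n) (hV0 n) (hV m) (hV0 m) hK
      ht (hk _ (mem_insert _ _)) (fun τ hτ => hk _ (mem_insert_of_mem _ (mem_image_of_mem F hτ)))
    have h2 : T * ((l n + l m) * (‖yosida J k‖ ^ 2 * (‖x₀‖ + T * K)))
        ≤ T * (2 * l n₀ * (‖yosida J k‖ ^ 2 * (‖x₀‖ + T * K))) := by
      gcongr
      linarith [hmono n hn, hmono m hm]
    have h3 : 4 * (e / (8 * (1 + T)) + T * (e / (8 * (1 + T)))) = e / 2 := by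
      field_simp
      ring
    linarith
  have hex : ∀ t ∈ Icc 0 T, ∃ x, Tendsto (fun n => V n t) atTop (𝓝 x) := fun t ht =>
    cauchySeq_tendsto_of_complete (hcauchy.cauchySeq ht)
  choose! W hW using hex
  have hunif : TendstoUniformlyOn V W atTop (Icc 0 T) :=
    hcauchy.tendstoUniformlyOn_of_tendsto hW
  have hWc : ContinuousOn W (Icc 0 T) :=
    hunif.continuousOn (Frequently.of_forall fun n => (hVc n).continuousOn)
  refine ⟨IccExtend hT (domRestrict (Icc 0 T) W), hWc.domRestrict.Icc_extend', ?_, fun t ht => ?_⟩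
  · rw [IccExtend_of_mem hT _ (left_mem_Icc.2 hT)]
    refine tendsto_nhds_unique (hW 0 (left_mem_Icc.2 hT)) ?_
    simp only [hV0]
    exact tendsto_const_nhds
  set U := IccExtend hT (domRestrict (Icc 0 T) W) with hUdef
  have hUc : Continuous U := hWc.domRestrict.Icc_extend'
  have hUW : ∀ τ ∈ Icc 0 T, U τ = W τ := fun τ hτ => IccExtend_of_mem hT _ hτ
  have hVn : ∀ n, ‖V n t‖ ≤ ‖x₀‖ + T * K := fun n => by
    have := norm_le_of_hasDerivAt_of_dissipative (hJ.yosida_dissipative hA (hl n)) (hV n) ht.1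
      (fun σ hσ => hK σ ⟨hσ.1, hσ.2.trans ht.2⟩)
    rw [hV0] at this
    refine this.trans ?_
    gcongr
    exact ht.2
  refine ⟨?_, ?_⟩
  · rw [hUW t ht]
    exact le_of_tendsto (hW t ht).norm (Eventually.of_forall hVn)
  have hint : Tendsto (fun n => ∫ τ in (0 : ℝ)..t, V n τ) atTop (𝓝 (∫ τ in (0 : ℝ)..t, U τ)) := by
    rw [Metric.tendsto_nhds]
    intro e he
    filter_upwards [Metric.tendstoUniformlyOn_iff.1 hunif (e / (1 + T)) (by positivity)] with n hn
    rw [dist_eq_norm, ← intervalIntegral.integral_sub ((hVc n).intervalIntegrable _ _)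
      (hUc.intervalIntegrable _ _)]
    have hle : ‖∫ τ in (0 : ℝ)..t, (V n τ - U τ)‖ ≤ e / (1 + T) * |t - 0| := by
      refine intervalIntegral.norm_integral_le_of_norm_le_const fun τ hτ => ?_
      rw [uIoc_of_le ht.1] at hτ
      have hτ' : τ ∈ Icc 0 T := ⟨hτ.1.le, hτ.2.trans ht.2⟩
      rw [hUW τ hτ', ← dist_eq_norm, dist_comm]
      exact (hn τ hτ').le
    refine hle.trans_lt ?_
    rw [sub_zero, abs_of_nonneg ht.1, div_mul_eq_mul_div, div_lt_iff₀ (by positivity)]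
    nlinarith [ht.2]
  have hmem : ∀ n, (J (l n) (∫ τ in (0 : ℝ)..t, V n τ), V n t - x₀ - ∫ τ in (0 : ℝ)..t, F τ)
      ∈ A := by
    intro n
    have hderiv := intervalIntegral.integral_eq_sub_of_hasDerivAt (a := 0) (b := t)
      (fun τ _ => hV n τ)
      ((((yosida J (l n)).continuous.comp (hVc n)).add hF).intervalIntegrable _ _)
    have hsum := intervalIntegral.integral_add (a := 0) (b := t) (μ := volume)
      (((yosida J (l n)).continuous.comp (hVc n)).intervalIntegrable _ _)
      (hF.intervalIntegrable _ _)
    simp only [Function.comp_apply] at hsum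
    rw [hsum, intervalIntegral_clm_comp _ (hVc n), hV0] at hderiv
    rw [← hderiv, add_sub_cancel_right]
    exact hJ.mem (hl n) _
  refine hA.isClosed.mem_of_tendsto (b := atTop) (Tendsto.prodMk_nhds ?_ ?_)
    (Eventually.of_forall hmem)
  · have h1 : Tendsto (fun n => J (l n) (∫ τ in (0 : ℝ)..t, U τ)) atTop
        (𝓝 (∫ τ in (0 : ℝ)..t, U τ)) := (hJ.tendsto hA _).comp hl0'
    have h2 : Tendsto (fun n => J (l n) ((∫ τ in (0 : ℝ)..t, V n τ) - ∫ τ in (0 : ℝ)..t, U τ))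
        atTop (𝓝 0) := by
      refine squeeze_zero_norm (fun n => hJ.norm_le hA (hl n) _) ?_
      have := (hint.sub_const (∫ τ in (0 : ℝ)..t, U τ)).norm
      rwa [sub_self, norm_zero] at this
    have := h2.add h1
    simpa only [map_sub, sub_add_cancel, zero_add] using this
  · rw [hUW t ht]
    exact ((hW t ht).sub_const _).sub_const _

end MildSolution

/-! ### The abstract damped wave equation as a first order system -/

section AbstractWave

variable {H : Type*} [NormedAddCommGroup H] [InnerProductSpace ℂ H]

/-- The graph of a self-adjoint operator: a single-valued linear relation which is its own
adjoint. -/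
structure IsSelfAdjointGraph (Γ : Submodule ℂ (H × H)) : Prop where
  eq_zero_of_mem : ∀ y, ((0 : H), y) ∈ Γ → y = 0
  mem_iff : ∀ z w, (z, w) ∈ Γ ↔ ∀ p ∈ Γ, inner ℂ p.2 z = inner ℂ p.1 w

theorem IsSelfAdjointGraph.isClosed {Γ : Submodule ℂ (H × H)} (hΓ : IsSelfAdjointGraph Γ) :
    IsClosed (Γ : Set (H × H)) := by
  have : (Γ : Set (H × H)) = ⋂ p ∈ Γ, {q | inner ℂ p.2 q.1 = inner ℂ p.1 q.2} := by
    ext ⟨z, w⟩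
    rw [SetLike.mem_coe, hΓ.mem_iff, mem_iInter₂]
    rfl
  rw [this]
  exact isClosed_biInter fun p _ => isClosed_eq (by fun_prop) (by fun_prop)

/-- The space of the states `(u_t, g^{1/2} Λ u, m^{1/2} u)`. -/
abbrev Triple (H : Type*) : Type _ := PiLp 2 (fun _ : Fin 3 => H)

theorem Triple.inner_eq (x y : Triple H) :
    inner ℂ x y = inner ℂ (x 0) (y 0) + inner ℂ (x 1) (y 1) + inner ℂ (x 2) (y 2) := by
  rw [PiLp.inner_apply, Fin.sum_univ_three]

theorem Triple.norm_toLp_le {V : Type*} [NormedAddCommGroup V] (a b c : V) :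
    ‖(WithLp.toLp 2 ![a, b, c] : Triple V)‖ ≤ ‖a‖ + ‖b‖ + ‖c‖ := by
  have h := PiLp.norm_sq_eq_of_L2 (fun _ : Fin 3 => V) (WithLp.toLp 2 ![a, b, c])
  rw [Fin.sum_univ_three] at h
  simp only [Matrix.cons_val] at h
  refine abs_le_of_sq_le_sq' ?_ (by positivity) |>.2
  rw [h]
  nlinarith [norm_nonneg a, norm_nonneg b, norm_nonneg c, mul_nonneg (norm_nonneg a) (norm_nonneg b),
    mul_nonneg (norm_nonneg a) (norm_nonneg c), mul_nonneg (norm_nonneg b) (norm_nonneg c)]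

/-- The graph of `(p, q, r) ↦ (-Λ G q - M r - B p, G Λ p, M p)`, the generator of the first order
system for `(p, q, r) = (u_t, G Λ u, M u)` that is equivalent to
`u_tt + Λ G² Λ u + M² u + B u_t = 0`. Here `Γ` is the graph of `Λ` and `G'` the inverse of `G`. -/
noncomputable def waveGraph (Γ : Submodule ℂ (H × H)) (G G' M B : H →L[ℂ] H) :
    Submodule ℂ (Triple H × Triple H) :=
  let pr (i : Fin 3) : Triple H →L[ℂ] H := PiLp.proj 2 (fun _ : Fin 3 => H) i
  let P (i : Fin 3) : Triple H × Triple H →L[ℂ] H := pr i ∘L ContinuousLinearMap.fst ℂ _ _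
  let Q (i : Fin 3) : Triple H × Triple H →L[ℂ] H := pr i ∘L ContinuousLinearMap.snd ℂ _ _
  Γ.comap ((P 0).prod (G' ∘L Q 1)).toLinearMap ⊓
    (LinearMap.ker (Q 2 - M ∘L P 0).toLinearMap ⊓
      Γ.comap ((G ∘L P 1).prod (-(Q 0 + M ∘L P 2 + B ∘L P 0))).toLinearMap)

theorem mem_waveGraph {Γ : Submodule ℂ (H × H)} {G G' M B : H →L[ℂ] H}
    {p : Triple H × Triple H} :
    p ∈ waveGraph Γ G G' M B ↔ (p.1 0, G' (p.2 1)) ∈ Γ ∧ p.2 2 = M (p.1 0) ∧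
      (G (p.1 1), -(p.2 0 + M (p.1 2) + B (p.1 0))) ∈ Γ := by
  simp [waveGraph, sub_eq_zero]

theorem isClosed_waveGraph {Γ : Submodule ℂ (H × H)} (hΓ : IsSelfAdjointGraph Γ)
    (G G' M B : H →L[ℂ] H) :
    IsClosed (waveGraph Γ G G' M B : Set (Triple H × Triple H)) :=
  (hΓ.isClosed.preimage (ContinuousLinearMap.continuous _)).inter
    ((ContinuousLinearMap.isClosed_ker _).inter
      (hΓ.isClosed.preimage (ContinuousLinearMap.continuous _)))

theorem isMaximalDissipative_waveGraph [CompleteSpace H] {Γ : Submodule ℂ (H × H)}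
    (hΓ : IsSelfAdjointGraph Γ) {G G' M B : H →L[ℂ] H}
    (hG : ∀ x y, inner ℂ (G x) y = inner ℂ x (G y)) (hM : ∀ x y, inner ℂ (M x) y = inner ℂ x (M y))
    (hB : ∀ x, 0 ≤ (inner ℂ (B x) x).re) (hGG' : ∀ x, G (G' x) = x) (hG'G : ∀ x, G' (G x) = x) :
    IsMaximalDissipative (waveGraph Γ G G' M B) := by
  have hG' : ∀ x y, inner ℂ (G' x) y = inner ℂ x (G' y) := fun x y => by
    rw [← hGG' y, ← hG, hGG', hGG']
  refine isMaximalDissipative_of_orthogonal (fun y hy => ?_) (isClosed_waveGraph hΓ G G' M B)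
    (fun p hp => ?_) (fun l hl z hz => ?_)
  · obtain ⟨h1, h2, h3⟩ := mem_waveGraph.1 hy
    simp only [PiLp.zero_apply, map_zero, add_zero] at h1 h2 h3
    have h0 : y 0 = 0 := neg_eq_zero.1 (hΓ.eq_zero_of_mem _ h3)
    have h1' : y 1 = 0 := by rw [← hGG' (y 1), hΓ.eq_zero_of_mem _ h1, map_zero]
    ext i
    fin_cases i
    · exact h0
    · exact h1'
    · exact h2
  · obtain ⟨h1, h2, h3⟩ := mem_waveGraph.1 hp
    have hs := (hΓ.mem_iff _ _).1 h3 _ h1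
    simp only at hs
    rw [hG', hG'G] at hs
    have e : p.2 0 = -(-(p.2 0 + M (p.1 2) + B (p.1 0))) - M (p.1 2) - B (p.1 0) := by abel
    rw [Triple.inner_eq, e, inner_sub_right, inner_sub_right, inner_neg_right, ← hs, h2]
    have r1 : (inner ℂ (p.2 1) (p.1 1)).re = (inner ℂ (p.1 1) (p.2 1)).re :=
      inner_re_symm (𝕜 := ℂ) _ _
    have r2 : (inner ℂ (p.1 2) (M (p.1 0))).re = (inner ℂ (p.1 0) (M (p.1 2))).re := by
      rw [← hM]
      exact inner_re_symm (𝕜 := ℂ) _ _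
    have r3 : (inner ℂ (p.1 0) (B (p.1 0))).re = (inner ℂ (B (p.1 0)) (p.1 0)).re :=
      inner_re_symm (𝕜 := ℂ) _ _
    simp only [Complex.add_re, Complex.sub_re, Complex.neg_re, r1, r2, r3]
    linarith [hB (p.1 0)]
  · -- the elements of the graph, parametrised by two elements of `Γ` and one vector
    have hpar : ∀ a w x v c, (a, w) ∈ Γ → (x, v) ∈ Γ →
        inner ℂ (x + (l : ℂ) • (w + M c + B x)) (z 0) + inner ℂ (G' a - (l : ℂ) • G v) (z 1)
          + inner ℂ (c - (l : ℂ) • M x) (z 2) = 0 := by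
      intro a w x v c haw hxv
      have e : (G (G' a), -(-(w + M c + B x) + M c + B x)) ∈ Γ := by
        rw [hGG', show -(-(w + M c + B x) + M c + B x) = w by abel]
        exact haw
      have := hz (WithLp.toLp 2 ![x, G' a, c], WithLp.toLp 2 ![-(w + M c + B x), G v, M x])
        (mem_waveGraph.2 ⟨by simpa [hG'G] using hxv, by simp, e⟩)
      rw [Triple.inner_eq] at this
      change inner ℂ (x - l • -(w + M c + B x)) (z 0) + inner ℂ (G' a - l • G v) (z 1)
          + inner ℂ (c - l • M x) (z 2) = 0 at this
      simpa only [Complex.coe_smul, smul_neg, sub_neg_eq_add] using this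
    have hl' : (l : ℂ) ≠ 0 := by exact_mod_cast hl.ne'
    -- self-adjointness of `Λ` puts `z 0` into its domain, so that it may serve as a test vector
    have h0 : (z 0, -(l : ℂ)⁻¹ • G' (z 1)) ∈ Γ := by
      rw [hΓ.mem_iff]
      rintro ⟨a, w⟩ haw
      have := hpar a w 0 0 0 haw Γ.zero_mem
      simp only [map_zero, add_zero, zero_add, smul_zero, sub_zero, inner_zero_left,
        inner_smul_left, Complex.conj_ofReal, hG'] at this
      simp only
      rw [inner_smul_right, eq_neg_of_add_eq_zero_right this]
      field_simp
    have h2 : z 2 = -((l : ℂ) • M (z 0)) := by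
      refine ext_inner_left ℂ fun c => ?_
      have := hpar 0 0 0 0 c Γ.zero_mem Γ.zero_mem
      simp only [map_zero, add_zero, zero_add, smul_zero, sub_zero, inner_zero_left,
        inner_smul_left, Complex.conj_ofReal, hM] at this
      rw [inner_neg_right, inner_smul_right, eq_neg_of_add_eq_zero_right this]
    -- tested with `x = z 0`, the three terms become squared norms, up to `l ⟨B z₀, z₀⟩ ≥ 0`
    have h3 := hpar 0 0 _ _ 0 Γ.zero_mem h0
    have e1 : (0 : H) - (l : ℂ) • M (z 0) = z 2 := by rw [h2, zero_sub]
    have e2 : G' 0 - (l : ℂ) • G (-(l : ℂ)⁻¹ • G' (z 1)) = z 1 := by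
      rw [map_smul, hGG', map_zero, zero_sub, neg_smul, smul_neg, neg_neg, smul_inv_smul₀ hl']
    rw [e1, e2, map_zero, zero_add, zero_add, inner_add_left, inner_smul_left,
      Complex.conj_ofReal] at h3
    have h4 := congrArg Complex.re h3
    have hn : ∀ x : H, (inner ℂ x x).re = ‖x‖ ^ 2 := fun x => inner_self_eq_norm_sq (𝕜 := ℂ) x
    simp only [Complex.add_re, hn, Complex.re_ofReal_mul, Complex.zero_re] at h4
    have hBz := mul_nonneg hl.le (hB (z 0))
    have z0 : ‖z 0‖ ^ 2 = 0 := by nlinarith [sq_nonneg ‖z 0‖, sq_nonneg ‖z 1‖, sq_nonneg ‖z 2‖]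
    have z1 : ‖z 1‖ ^ 2 = 0 := by nlinarith [sq_nonneg ‖z 0‖, sq_nonneg ‖z 1‖, sq_nonneg ‖z 2‖]
    have z2 : ‖z 2‖ ^ 2 = 0 := by nlinarith [sq_nonneg ‖z 0‖, sq_nonneg ‖z 1‖, sq_nonneg ‖z 2‖]
    ext i
    fin_cases i
    · simpa using z0
    · simpa using z1
    · simpa using z2

/-- The abstract Cauchy problem `u_tt + Λ G² Λ u + M² u + B u_t = F`, `u(0) = u₀`, `u_t(0) = u₁`,
with `Γ` the graph of the self-adjoint operator `Λ`. The function `h` is `Λ u`. -/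
theorem exists_wave [CompleteSpace H] {Γ : Submodule ℂ (H × H)}
    (hΓ : IsSelfAdjointGraph Γ) {G G' M B : H →L[ℂ] H}
    (hG : ∀ x y, inner ℂ (G x) y = inner ℂ x (G y)) (hM : ∀ x y, inner ℂ (M x) y = inner ℂ x (M y))
    (hB : ∀ x, 0 ≤ (inner ℂ (B x) x).re) (hGG' : ∀ x, G (G' x) = x) (hG'G : ∀ x, G' (G x) = x)
    {T : ℝ} (hT : 0 ≤ T) {F : ℝ → H} (hF : Continuous F) {K : ℝ} (hK : ∀ t ∈ Icc 0 T, ‖F t‖ ≤ K)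
    {u₀ v₀ : H} (h₀ : (u₀, v₀) ∈ Γ) (u₁ : H) :
    ∃ u p h : ℝ → H, (∀ t, HasDerivAt u (p t) t) ∧ Continuous p ∧ Continuous h ∧
      u 0 = u₀ ∧ p 0 = u₁ ∧ (∀ t ∈ Icc 0 T, (u t, h t) ∈ Γ) ∧
      (∀ t ∈ Icc 0 T, ‖p t‖ ≤ ‖u₁‖ + ‖G v₀‖ + ‖M u₀‖ + T * K) ∧
      (∀ t ∈ Icc 0 T, ‖h t‖ ≤ ‖G'‖ * (‖u₁‖ + ‖G v₀‖ + ‖M u₀‖ + T * K)) ∧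
      ∀ φ ψ, (φ, ψ) ∈ Γ → ∀ t ∈ Icc 0 T, HasDerivWithinAt (fun τ => inner ℂ φ (p τ))
        (inner ℂ φ (F t) - inner ℂ ψ (G (G (h t))) - inner ℂ φ (M (M (u t))) - inner ℂ φ (B (p t)))
        (Icc 0 T) t := by
  let pr (i : Fin 3) : Triple H →L[ℂ] H := PiLp.proj 2 (fun _ : Fin 3 => H) i
  have hFc : Continuous fun t => (WithLp.toLp 2 ![F t, 0, 0] : Triple H) := by
    refine (PiLp.continuous_toLp 2 _).comp (continuous_pi fun i => ?_)
    fin_cases i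
    · exact hF
    · exact continuous_const
    · exact continuous_const
  obtain ⟨U, hUc, hU0, hU⟩ := exists_mildSolution (isMaximalDissipative_waveGraph hΓ hG hM hB hGG'
    hG'G) hT hFc (K := K) (fun t ht => (Triple.norm_toLp_le _ _ _).trans (by simpa using hK t ht))
    (WithLp.toLp 2 ![u₁, G v₀, M u₀])
  have hprc : ∀ i, Continuous fun t => U t i := fun i => (pr i).continuous.comp hUc
  have hprI : ∀ (i : Fin 3) t, (∫ τ in (0 : ℝ)..t, U τ) i = ∫ τ in (0 : ℝ)..t, U τ i :=
    fun i t => (intervalIntegral_clm_comp (pr i) hUc t).symm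
  have hFI : ∀ (i : Fin 3) t, (∫ τ in (0 : ℝ)..t, (WithLp.toLp 2 ![F τ, 0, 0] : Triple H)) i
      = ∫ τ in (0 : ℝ)..t, (![F τ, 0, 0] : Fin 3 → H) i :=
    fun i t => (intervalIntegral_clm_comp (pr i) hFc t).symm
  have hU' : ∀ t ∈ Icc 0 T,
      (∫ τ in (0 : ℝ)..t, U τ 0, G' (U t 1 - G v₀)) ∈ Γ ∧
      U t 2 - M u₀ = M (∫ τ in (0 : ℝ)..t, U τ 0) ∧
      (G (∫ τ in (0 : ℝ)..t, U τ 1), -((U t 0 - u₁ - ∫ τ in (0 : ℝ)..t, F τ)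
        + M (∫ τ in (0 : ℝ)..t, U τ 2) + B (∫ τ in (0 : ℝ)..t, U τ 0))) ∈ Γ := by
    intro t ht
    have := mem_waveGraph.1 (hU t ht).2
    simpa [hprI, hFI] using this
  have hbd : ∀ i, ∀ t ∈ Icc 0 T, ‖U t i‖ ≤ ‖u₁‖ + ‖G v₀‖ + ‖M u₀‖ + T * K := fun i t ht =>
    (PiLp.norm_apply_le (U t) i).trans ((hU t ht).1.trans
      (add_le_add_left (Triple.norm_toLp_le _ _ _) _))
  have hI : ∀ i t, HasDerivAt (fun t => ∫ τ in (0 : ℝ)..t, U τ i) (U t i) t := fun i t =>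
    ((hprc i).integral_hasStrictDerivAt 0 t).hasDerivAt
  -- the third component of the state is `M u`
  have hM' : ∀ t ∈ Icc 0 T, U t 2 = M (u₀ + ∫ τ in (0 : ℝ)..t, U τ 0) := fun t ht => by
    rw [map_add, ← (hU' t ht).2.1, add_sub_cancel]
  refine ⟨fun t => u₀ + ∫ τ in (0 : ℝ)..t, U τ 0, fun t => U t 0, fun t => G' (U t 1),
    fun t => (hI 0 t).const_add u₀, hprc 0, G'.continuous.comp (hprc 1), by simp, by simp [hU0],
    fun t ht => ?_, hbd 0, fun t ht => ?_, fun φ ψ hφ t ht => ?_⟩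
  · have := Γ.add_mem h₀ (hU' t ht).1
    rwa [Prod.mk_add_mk, map_sub, hG'G, add_sub_cancel] at this
  · exact (G'.le_opNorm _).trans (by gcongr; exact hbd 1 t ht)
  · -- the equation in integrated form, tested against `φ`
    have hform : ∀ τ ∈ Icc 0 T, inner ℂ φ (U τ 0) = inner ℂ φ (u₁ + ((∫ σ in (0 : ℝ)..τ, F σ)
        - M (∫ σ in (0 : ℝ)..τ, U σ 2) - B (∫ σ in (0 : ℝ)..τ, U σ 0)))
        - inner ℂ ψ (G (∫ σ in (0 : ℝ)..τ, U σ 1)) := by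
      intro τ hτ
      have h1 := (hΓ.mem_iff _ _).1 (hU' τ hτ).2.2 _ hφ
      simp only at h1
      rw [h1, ← inner_sub_right]
      congr 1
      abel
    have hd1 : HasDerivAt (fun τ => u₁ + ((∫ σ in (0 : ℝ)..τ, F σ)
        - M (∫ σ in (0 : ℝ)..τ, U σ 2) - B (∫ σ in (0 : ℝ)..τ, U σ 0)))
        (F t - M (U t 2) - B (U t 0)) t :=
      ((((hF.integral_hasStrictDerivAt 0 t).hasDerivAt).sub (hasDerivAt_clm_comp M (hI 2 t))).sub
        (hasDerivAt_clm_comp B (hI 0 t))).const_add u₁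
    have hd := (hasDerivAt_clm_comp (innerSL ℂ φ) hd1).sub
      (hasDerivAt_clm_comp (innerSL ℂ ψ) (hasDerivAt_clm_comp G (hI 1 t)))
    refine (hd.hasDerivWithinAt.congr (fun τ hτ => hform τ hτ) (hform t ht)).congr_deriv ?_
    simp only [innerSL_apply_apply, inner_sub_right, hGG', hM' t ht]
    ring

end AbstractWave

/-! ### Multiplication operators -/

section Multiplication

variable {d : ℕ}

/-- Multiplication by a bounded real-valued function, as an operator in `L²(ℝ^d)`. -/
noncomputable def mulOp {a : Space d → ℝ} (ha : MemLp a ∞ volume) : L2 d →L[ℂ] L2 d :=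
  (ContinuousLinearMap.mul ℂ ℂ).holderL volume ∞ 2 2 (ha.ofReal (K := ℂ)).toLp

theorem coeFn_mulOp {a : Space d → ℝ} (ha : MemLp a ∞ volume) (f : L2 d) :
    mulOp ha f =ᵐ[volume] fun x => (a x : ℂ) * f x := by
  have h1 := (ContinuousLinearMap.mul ℂ ℂ).coeFn_holder (r := 2) (ha.ofReal (K := ℂ)).toLp f
  filter_upwards [h1, (ha.ofReal (K := ℂ)).coeFn_toLp] with x hx hx'
  rw [mulOp, ContinuousLinearMap.holderL_apply_apply, hx, hx']
  rfl

theorem inner_L2_eq (f h : L2 d) : inner ℂ f h = ∫ x, h x * conj (f x) := by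
  rw [L2.inner_def]
  rfl

theorem inner_mulOp_comm {a : Space d → ℝ} (ha : MemLp a ∞ volume) (f h : L2 d) :
    inner ℂ (mulOp ha f) h = inner ℂ f (mulOp ha h) := by
  rw [inner_L2_eq, inner_L2_eq]
  refine integral_congr_ae ?_
  filter_upwards [coeFn_mulOp ha f, coeFn_mulOp ha h] with x hx hx'
  rw [hx, hx', map_mul, Complex.conj_ofReal]
  ring

theorem inner_mulOp_self_nonneg {a : Space d → ℝ} (ha : MemLp a ∞ volume) (h0 : ∀ x, 0 ≤ a x)
    (f : L2 d) : 0 ≤ (inner ℂ (mulOp ha f) f).re := by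
  rw [inner_L2_eq]
  have e : ∫ x, f x * conj (mulOp ha f x) = ((∫ x, a x * ‖f x‖ ^ 2 : ℝ) : ℂ) := by
    rw [← integral_complex_ofReal]
    refine integral_congr_ae ?_
    filter_upwards [coeFn_mulOp ha f] with x hx
    rw [hx, map_mul, Complex.conj_ofReal, mul_left_comm, Complex.mul_conj, Complex.normSq_eq_norm_sq]
    push_cast
    ring
  rw [e, Complex.ofReal_re]
  exact integral_nonneg fun x => mul_nonneg (h0 x) (sq_nonneg _)

theorem mulOp_mulOp {a b c : Space d → ℝ} (ha : MemLp a ∞ volume) (hb : MemLp b ∞ volume)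
    (hc : MemLp c ∞ volume) (h : ∀ x, a x * b x = c x) (f : L2 d) :
    mulOp ha (mulOp hb f) = mulOp hc f := by
  refine Lp.ext ?_
  filter_upwards [coeFn_mulOp ha (mulOp hb f), coeFn_mulOp hb f, coeFn_mulOp hc f] with x h1 h2 h3
  rw [h1, h2, h3, ← h]
  push_cast
  ring

theorem mulOp_mulOp_eq_self {a b : Space d → ℝ} (ha : MemLp a ∞ volume) (hb : MemLp b ∞ volume)
    (h : ∀ x, a x * b x = 1) (f : L2 d) : mulOp ha (mulOp hb f) = f := by
  refine Lp.ext ?_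
  filter_upwards [coeFn_mulOp ha (mulOp hb f), coeFn_mulOp hb f] with x h1 h2
  rw [h1, h2, ← mul_assoc, ← Complex.ofReal_mul, h, Complex.ofReal_one, one_mul]

theorem norm_mulOp_apply_le {a : Space d → ℝ} (ha : MemLp a ∞ volume) {C : ℝ}
    (hC : ∀ᵐ x, ‖a x‖ ≤ C) (f : L2 d) : ‖mulOp ha f‖ ≤ C * ‖f‖ := by
  refine Lp.norm_le_mul_norm_of_ae_le_mul ?_
  filter_upwards [coeFn_mulOp ha f, hC] with x hx hx'
  rw [hx, norm_mul, Complex.norm_real]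
  gcongr

end Multiplication

/-! ### The fractional Laplacian as a self-adjoint operator -/

section FractionalLaplacian

variable {d : ℕ}

theorem fracSymbol_nonneg (σ : ℝ) (ξ : Space d) : 0 ≤ fracSymbol σ ξ :=
  Real.rpow_nonneg (by positivity) _

theorem fracSymbol_half_sq (s : ℝ) (ξ : Space d) : fracSymbol (s / 2) ξ ^ 2 = fracSymbol s ξ := by
  rw [fracSymbol, fracSymbol, ← Real.rpow_natCast, ← Real.rpow_mul (by positivity)]
  congr 1
  push_cast
  ring

theorem measurable_fracSymbol (σ : ℝ) : Measurable (fracSymbol σ : Space d → ℝ) := by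
  unfold fracSymbol
  fun_prop

theorem memLp_top_inv_one_add (σ : ℝ) :
    MemLp (fun ξ : Space d => (1 + fracSymbol σ ξ)⁻¹) ∞ volume := by
  refine memLp_top_of_bound (C := 1)
    ((measurable_fracSymbol σ).const_add 1).inv.aestronglyMeasurable (ae_of_all _ fun ξ => ?_)
  have := fracSymbol_nonneg σ ξ
  rw [Real.norm_of_nonneg (by positivity)]
  exact inv_le_one_of_one_le₀ (by linarith)

theorem memLp_top_div_one_add (σ : ℝ) :
    MemLp (fun ξ : Space d => fracSymbol σ ξ / (1 + fracSymbol σ ξ)) ∞ volume := by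
  refine memLp_top_of_bound (C := 1) ((measurable_fracSymbol σ).div
    ((measurable_fracSymbol σ).const_add 1)).aestronglyMeasurable (ae_of_all _ fun ξ => ?_)
  have := fracSymbol_nonneg σ ξ
  rw [Real.norm_of_nonneg (by positivity)]
  exact div_le_one_of_le₀ (by linarith) (by positivity)

/-- The graph of `(-Δ)^σ` in `L²(ℝ^d)`: the pairs `(f, h)` with `|η|^{2σ} 𝓕 f = 𝓕 h`. Dividing this
relation by `1 + |η|^{2σ}` makes both sides bounded operators in `L²`. -/
noncomputable def laplacianGraph (d : ℕ) (σ : ℝ) : Submodule ℂ (L2 d × L2 d) :=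
  let 𝓕' : L2 d →L[ℂ] L2 d := (Lp.fourierTransformₗᵢ (Space d) ℂ).toContinuousLinearEquiv
  LinearMap.ker ((mulOp (memLp_top_div_one_add σ) ∘L 𝓕' ∘L ContinuousLinearMap.fst ℂ _ _
    - mulOp (memLp_top_inv_one_add σ) ∘L 𝓕' ∘L ContinuousLinearMap.snd ℂ _ _).toLinearMap)

theorem mem_laplacianGraph_iff_mulOp {σ : ℝ} {f h : L2 d} : (f, h) ∈ laplacianGraph d σ ↔
    mulOp (memLp_top_div_one_add σ) (𝓕 f) = mulOp (memLp_top_inv_one_add σ) (𝓕 h) := by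
  rw [laplacianGraph, LinearMap.mem_ker]
  exact sub_eq_zero

theorem mem_laplacianGraph {σ : ℝ} {f h : L2 d} : (f, h) ∈ laplacianGraph d σ ↔
    (fun ξ => (fracSymbol σ ξ : ℂ) * (𝓕 f : L2 d) ξ) =ᵐ[volume] (𝓕 h : L2 d) := by
  rw [mem_laplacianGraph_iff_mulOp, Lp.ext_iff]
  have key : ∀ (ξ : Space d) (x y : ℂ),
      ((fracSymbol σ ξ / (1 + fracSymbol σ ξ) : ℝ) : ℂ) * x = (((1 + fracSymbol σ ξ)⁻¹ : ℝ) : ℂ) * y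
        ↔ (fracSymbol σ ξ : ℂ) * x = y := by
    intro ξ x y
    have h0 : ((1 + fracSymbol σ ξ : ℝ) : ℂ) ≠ 0 := by
      have := fracSymbol_nonneg σ ξ
      exact_mod_cast (by positivity : (1 + fracSymbol σ ξ) ≠ 0)
    rw [div_eq_inv_mul, Complex.ofReal_mul, mul_assoc]
    refine mul_right_inj' ?_
    rw [Complex.ofReal_inv]
    exact inv_ne_zero h0
  refine ⟨fun H => ?_, fun H => ?_⟩
  · filter_upwards [H, coeFn_mulOp (memLp_top_div_one_add σ) (𝓕 f),
      coeFn_mulOp (memLp_top_inv_one_add σ) (𝓕 h)] with ξ h1 h2 h3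
    rw [h2, h3] at h1
    exact (key ξ _ _).1 h1
  · filter_upwards [H, coeFn_mulOp (memLp_top_div_one_add σ) (𝓕 f),
      coeFn_mulOp (memLp_top_inv_one_add σ) (𝓕 h)] with ξ h1 h2 h3
    rw [h2, h3]
    exact (key ξ _ _).2 h1

/-- `(-Δ)^σ` is self-adjoint. -/
theorem isSelfAdjointGraph_laplacianGraph (d : ℕ) (σ : ℝ) :
    IsSelfAdjointGraph (laplacianGraph d σ) := by
  refine ⟨fun y hy => ?_, fun z w => ⟨fun hzw => ?_, fun H => ?_⟩⟩
  · rw [mem_laplacianGraph] at hy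
    have h0 : (𝓕 (0 : L2 d) : L2 d) = 0 := (Lp.fourierTransformₗᵢ (Space d) ℂ).map_zero
    have h1 : (𝓕 y : L2 d) = 0 := by
      refine Lp.ext ?_
      filter_upwards [hy, Lp.coeFn_zero ℂ 2 (volume : Measure (Space d))] with ξ h1 h2
      rw [← h1, h0, h2]
      simp
    rw [← norm_eq_zero, ← Lp.norm_fourier_eq, h1, norm_zero]
  · rintro ⟨f, h⟩ hp
    rw [mem_laplacianGraph] at hp hzw
    simp only
    rw [← Lp.inner_fourier_eq, ← Lp.inner_fourier_eq f w, inner_L2_eq, inner_L2_eq]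
    refine integral_congr_ae ?_
    filter_upwards [hp, hzw] with ξ h1 h2
    rw [← h1, ← h2, map_mul, Complex.conj_ofReal]
    ring
  · rw [mem_laplacianGraph_iff_mulOp]
    refine ext_inner_left ℂ fun a => ?_
    -- test pairs: the Fourier multipliers `1 / (1 + |η|^{2σ})` and `|η|^{2σ} / (1 + |η|^{2σ})` at `a`
    have hmem : ((𝓕⁻ (mulOp (memLp_top_inv_one_add σ) a) : L2 d),
        (𝓕⁻ (mulOp (memLp_top_div_one_add σ) a) : L2 d)) ∈ laplacianGraph d σ := by
      rw [mem_laplacianGraph_iff_mulOp, FourierTransform.fourier_fourierInv_eq,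
        FourierTransform.fourier_fourierInv_eq]
      refine Lp.ext ?_
      filter_upwards [coeFn_mulOp (memLp_top_inv_one_add σ) a,
        coeFn_mulOp (memLp_top_div_one_add σ) a,
        coeFn_mulOp (memLp_top_div_one_add σ) (mulOp (memLp_top_inv_one_add σ) a),
        coeFn_mulOp (memLp_top_inv_one_add σ) (mulOp (memLp_top_div_one_add σ) a)]
        with ξ h1 h2 h3 h4
      rw [h3, h4, h1, h2]
      ring
    have := H _ hmem
    simp only at this
    rw [← Lp.inner_fourier_eq, ← Lp.inner_fourier_eq _ w, FourierTransform.fourier_fourierInv_eq,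
      FourierTransform.fourier_fourierInv_eq, inner_mulOp_comm, inner_mulOp_comm] at this
    exact this

theorem fracLaplacian_eq_of_mem {σ : ℝ} {f h : L2 d} (hfh : (f, h) ∈ laplacianGraph d σ) :
    fracLaplacian σ f = h := by
  rw [mem_laplacianGraph] at hfh
  have hm : MemLp (fun ξ : Space d => (fracSymbol σ ξ : ℂ) * (𝓕 f : L2 d) ξ) 2 volume :=
    (memLp_congr_ae hfh).2 (Lp.memLp _)
  rw [fracLaplacian, dif_pos hm]
  have : hm.toLp _ = (𝓕 h : L2 d) := Lp.ext (hm.coeFn_toLp.trans hfh)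
  rw [this, FourierTransform.fourierInv_fourier_eq]

theorem lintegral_enorm_sq_eq (f : L2 d) : ∫⁻ x, ‖f x‖ₑ ^ 2 = ‖f‖ₑ ^ 2 := by
  have := eLpNorm_nnreal_pow_eq_lintegral (f := f) (μ := volume) (p := 2) (by norm_num)
  rw [Lp.enorm_def]
  simpa using this.symm

theorem enorm_fourier_eq (f : L2 d) : ‖(𝓕 f : L2 d)‖ₑ = ‖f‖ₑ := by
  rw [← ofReal_norm, ← ofReal_norm, Lp.norm_fourier_eq]

theorem ofReal_one_add_fracSymbol_mul (s : ℝ) (ξ : Space d) (z : ℂ) :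
    ENNReal.ofReal (1 + fracSymbol s ξ) * ‖z‖ₑ ^ 2
      = ‖z‖ₑ ^ 2 + ‖(fracSymbol (s / 2) ξ : ℂ) * z‖ₑ ^ 2 := by
  rw [← fracSymbol_half_sq, ENNReal.ofReal_add zero_le_one (sq_nonneg _), ENNReal.ofReal_one,
    add_mul, one_mul, enorm_mul, mul_pow, ENNReal.ofReal_pow (fracSymbol_nonneg _ _)]
  congr 3
  rw [← ofReal_norm, Complex.norm_real, Real.norm_of_nonneg (fracSymbol_nonneg _ _)]

/-- The norm of `H^s` is the graph norm of `(-Δ)^{s/2}`. -/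
theorem hsENorm_eq_of_mem {s : ℝ} {f h : L2 d} (hfh : (f, h) ∈ laplacianGraph d (s / 2)) :
    hsENorm s f = (‖f‖ₑ ^ 2 + ‖h‖ₑ ^ 2) ^ (1 / 2 : ℝ) := by
  rw [mem_laplacianGraph] at hfh
  rw [hsENorm, ← enorm_fourier_eq f, ← enorm_fourier_eq h, ← lintegral_enorm_sq_eq,
    ← lintegral_enorm_sq_eq, ← lintegral_add_left' (by fun_prop)]
  congr 1
  refine lintegral_congr_ae ?_
  filter_upwards [hfh] with ξ hξ
  rw [ofReal_one_add_fracSymbol_mul, hξ]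

theorem memHs_of_mem {s : ℝ} {f h : L2 d} (hfh : (f, h) ∈ laplacianGraph d (s / 2)) :
    MemHs s f := by
  rw [MemHs, hsENorm_eq_of_mem hfh]
  finiteness

/-- `H^s(ℝ^d)` is the domain of `(-Δ)^{s/2}`. -/
theorem exists_mem_laplacianGraph {s : ℝ} {f : L2 d} (hf : MemHs s f) :
    ∃ h, (f, h) ∈ laplacianGraph d (s / 2) := by
  have hm : MemLp (fun ξ : Space d => (fracSymbol (s / 2) ξ : ℂ) * (𝓕 f : L2 d) ξ) 2 volume := by
    refine ⟨(Complex.measurable_ofReal.comp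
      (measurable_fracSymbol _)).aestronglyMeasurable.mul (Lp.aestronglyMeasurable _), ?_⟩
    rw [eLpNorm_lt_top_iff_lintegral_rpow_enorm_lt_top (by norm_num) (by norm_num)]
    have h1 : ∫⁻ ξ : Space d, ENNReal.ofReal (1 + fracSymbol s ξ) * ‖(𝓕 f : L2 d) ξ‖ₑ ^ 2 < ∞ := by
      rw [MemHs, hsENorm, ENNReal.rpow_lt_top_iff_of_pos (by norm_num)] at hf
      exact hf
    refine lt_of_le_of_lt (lintegral_mono fun ξ => ?_) h1
    simp only [ofReal_one_add_fracSymbol_mul, ENNReal.toReal_ofNat, ENNReal.rpow_ofNat]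
    exact le_add_self
  refine ⟨𝓕⁻ (hm.toLp _ : L2 d), mem_laplacianGraph.2 ?_⟩
  rw [FourierTransform.fourier_fourierInv_eq]
  exact hm.coeFn_toLp.symm

theorem enorm_le_hsENorm {s : ℝ} {f h : L2 d} (hfh : (f, h) ∈ laplacianGraph d (s / 2)) :
    ‖f‖ₑ ≤ hsENorm s f ∧ ‖h‖ₑ ≤ hsENorm s f := by
  have key : ∀ a : ℝ≥0∞, a = (a ^ 2) ^ (1 / 2 : ℝ) := fun a => by
    rw [← ENNReal.rpow_natCast, ← ENNReal.rpow_mul]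
    norm_num
  rw [hsENorm_eq_of_mem hfh]
  constructor
  · nth_rw 1 [key ‖f‖ₑ]
    gcongr
    exact le_self_add
  · nth_rw 1 [key ‖h‖ₑ]
    gcongr
    exact le_add_self

end FractionalLaplacian

/-! ### The Cauchy problem with bounded coefficients -/

section RegularProblem

variable {d : ℕ}

theorem ae_norm_le_of_eLpNorm_top_le {F : Type*} [NormedAddCommGroup F] {a : Space d → F} {K : ℝ}
    (hK : 0 ≤ K) (h : eLpNorm a ∞ volume ≤ ENNReal.ofReal K) : ∀ᵐ x, ‖a x‖ ≤ K := by
  rw [eLpNorm_exponent_top] at h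
  filter_upwards [ae_le_eLpNormEssSup (f := a) (μ := (volume : Measure (Space d)))] with x hx
  have := hx.trans h
  rwa [← ofReal_norm, ENNReal.ofReal_le_ofReal_iff hK] at this

theorem ae_norm_sqrt_le {a : Space d → ℝ} {K : ℝ} (h : ∀ᵐ x, ‖a x‖ ≤ K) :
    ∀ᵐ x, ‖√(a x)‖ ≤ √K := by
  filter_upwards [h] with x hx
  rw [Real.norm_of_nonneg (Real.sqrt_nonneg _)]
  exact Real.sqrt_le_sqrt ((le_abs_self _).trans hx)

theorem norm_inv_sqrt_le {y c : ℝ} (hc : 0 < c) (h : c ≤ y) : ‖(√y)⁻¹‖ ≤ (√c)⁻¹ := by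
  rw [Real.norm_of_nonneg (by positivity)]
  exact inv_anti₀ (Real.sqrt_pos.2 hc) (Real.sqrt_le_sqrt h)

theorem aestronglyMeasurable_sqrt {a : Space d → ℝ} (ha : AEStronglyMeasurable a volume) :
    AEStronglyMeasurable (fun x => √(a x)) volume :=
  Real.continuous_sqrt.comp_aestronglyMeasurable ha

/-- A source in `C([0,T]; L²)` is the restriction of a continuous function of `t ∈ ℝ`. -/
theorem exists_continuous_source {T : ℝ} (hT : 0 ≤ T) {f : ℝ → Space d → ℂ} {K : ℝ} (hK0 : 0 ≤ K)
    (hf : ∀ t ∈ Icc 0 T, MemLp (f t) 2 volume ∧ eLpNorm (f t) 2 volume ≤ ENNReal.ofReal K ∧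
      Tendsto (fun τ => eLpNorm (f τ - f t) 2 volume) (𝓝[Icc 0 T] t) (𝓝 0)) :
    ∃ F : ℝ → L2 d, Continuous F ∧ ∀ t ∈ Icc 0 T, F t =ᵐ[volume] f t ∧ ‖F t‖ ≤ K := by
  let F₀ : Icc 0 T → L2 d := fun t => (hf t t.2).1.toLp
  have hF₀ : Continuous F₀ := by
    refine continuous_iff_continuousAt.2 fun t => ?_
    refine (Lp.tendsto_Lp_iff_tendsto_eLpNorm'' (fun τ : Icc 0 T => f τ)
      (fun τ => (hf τ τ.2).1) (f t) (hf t t.2).1).2 ?_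
    have := (hf t t.2).2.2
    rw [← map_nhds_subtype_val, tendsto_map'_iff] at this
    exact this
  refine ⟨IccExtend hT F₀, hF₀.Icc_extend', fun t ht => ?_⟩
  rw [IccExtend_of_mem hT F₀ ht]
  refine ⟨(hf t ht).1.coeFn_toLp, ?_⟩
  rw [Lp.norm_toLp]
  exact ENNReal.toReal_le_of_le_ofReal hK0 (hf t ht).2.1

theorem memC1_of_hasDerivAt {s T : ℝ} {u p h : ℝ → L2 d}
    (hu : ∀ t, HasDerivAt u (p t) t) (hp : Continuous p) (hh : Continuous h)
    (hmem : ∀ t ∈ Icc 0 T, (u t, h t) ∈ laplacianGraph d (s / 2)) : MemC1 s T u := by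
  refine ⟨fun t ht => memHs_of_mem (hmem t ht), fun t ht => ?_, ?_⟩
  · have hev : (fun τ => (‖u τ - u t‖ₑ ^ 2 + ‖h τ - h t‖ₑ ^ 2) ^ (1 / 2 : ℝ))
        =ᶠ[𝓝[Icc 0 T] t] fun τ => hsENorm s (u τ - u t) := by
      filter_upwards [self_mem_nhdsWithin] with τ hτ
      have := (laplacianGraph d (s / 2)).sub_mem (hmem τ hτ) (hmem t ht)
      rw [Prod.mk_sub_mk] at this
      exact (hsENorm_eq_of_mem this).symm
    refine Tendsto.congr' hev ?_
    have huc : Continuous u := continuous_iff_continuousAt.2 fun t => (hu t).continuousAt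
    have hc : Continuous fun τ => (‖u τ - u t‖ₑ ^ 2 + ‖h τ - h t‖ₑ ^ 2) ^ (1 / 2 : ℝ) :=
      ENNReal.continuous_rpow_const.comp
        (((ENNReal.continuous_pow 2).comp (huc.sub continuous_const).enorm).add
          ((ENNReal.continuous_pow 2).comp (hh.sub continuous_const).enorm))
    have := (hc.tendsto t).mono_left (nhdsWithin_le_nhds (s := Icc 0 T))
    simpa using this
  · have : ContDiff ℝ 1 u := by
      rw [contDiff_one_iff_deriv]
      refine ⟨fun t => (hu t).differentiableAt, ?_⟩
      rwa [funext fun t => (hu t).deriv]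
    exact this.contDiffOn

/-- The Cauchy problem with bounded coefficients, `g ≥ c > 0` and `m, b ≥ 0`, has a solution whose
norm is bounded polynomially by the norms of the coefficients and of the data. No bound of `b`
enters, and none of the others enters exponentially. -/
theorem exists_isSolution {s T : ℝ} (hT : 0 < T) {g m b : Space d → ℝ} {f : ℝ → Space d → ℂ}
    {v₀ v₁ : Space d → ℂ} {c Kg Km Kf K₀ K₁ : ℝ} (hc : 0 < c) (hKg : 0 ≤ Kg) (hKm : 0 ≤ Km)
    (hKf : 0 ≤ Kf) (hK₀ : 0 ≤ K₀) (hK₁ : 0 ≤ K₁)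
    (hg : MemLp g ∞ volume) (hgK : eLpNorm g ∞ volume ≤ ENNReal.ofReal Kg) (hgc : ∀ x, c ≤ g x)
    (hm : MemLp m ∞ volume) (hmK : eLpNorm m ∞ volume ≤ ENNReal.ofReal Km) (hm0 : ∀ x, 0 ≤ m x)
    (hb : MemLp b ∞ volume) (hb0 : ∀ x, 0 ≤ b x)
    (hf : ∀ t ∈ Icc 0 T, MemLp (f t) 2 volume ∧ eLpNorm (f t) 2 volume ≤ ENNReal.ofReal Kf ∧
      Tendsto (fun τ => eLpNorm (f τ - f t) 2 volume) (𝓝[Icc 0 T] t) (𝓝 0))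
    (hv₀ : ∃ v : L2 d, v =ᵐ[volume] v₀ ∧ hsENorm s v ≤ ENNReal.ofReal K₀)
    (hv₁ : MemLp v₁ 2 volume) (hv₁K : eLpNorm v₁ 2 volume ≤ ENNReal.ofReal K₁) :
    ∃ u : ℝ → L2 d, IsSolution s T g m b f v₀ v₁ u ∧ ∀ t ∈ Icc 0 T,
      norm1 s T u t ≤ K₀ + (1 + T + (√c)⁻¹) * (K₁ + √Kg * K₀ + √Km * K₀ + T * Kf) := by
  obtain ⟨F, hFc, hF⟩ := exists_continuous_source hT.le hKf hf
  obtain ⟨v, hvv, hvK⟩ := hv₀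
  obtain ⟨w, hvw⟩ := exists_mem_laplacianGraph (show MemHs s v from hvK.trans_lt ENNReal.ofReal_lt_top)
  have hvn : ‖v‖ ≤ K₀ := by
    have := (enorm_le_hsENorm hvw).1.trans hvK
    rwa [← ofReal_norm, ENNReal.ofReal_le_ofReal_iff hK₀] at this
  have hwn : ‖w‖ ≤ K₀ := by
    have := (enorm_le_hsENorm hvw).2.trans hvK
    rwa [← ofReal_norm, ENNReal.ofReal_le_ofReal_iff hK₀] at this
  have hv₁n : ‖hv₁.toLp‖ ≤ K₁ := by
    rw [Lp.norm_toLp]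
    exact ENNReal.toReal_le_of_le_ofReal hK₁ hv₁K
  have hg0 : ∀ x, 0 < g x := fun x => hc.trans_le (hgc x)
  have hgae := ae_norm_sqrt_le (ae_norm_le_of_eLpNorm_top_le hKg hgK)
  have hmae := ae_norm_sqrt_le (ae_norm_le_of_eLpNorm_top_le hKm hmK)
  have hgs := memLp_top_of_bound (aestronglyMeasurable_sqrt hg.1) _ hgae
  have hms := memLp_top_of_bound (aestronglyMeasurable_sqrt hm.1) _ hmae
  have hgi' : ∀ᵐ x, ‖(√(g x))⁻¹‖ ≤ (√c)⁻¹ := ae_of_all _ fun x => norm_inv_sqrt_le hc (hgc x)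
  have hgi : MemLp (fun x => (√(g x))⁻¹) ∞ volume :=
    memLp_top_of_bound (aestronglyMeasurable_sqrt hg.1).inv₀ _ hgi'
  have hgne : ∀ x, √(g x) ≠ 0 := fun x => (Real.sqrt_pos.2 (hg0 x)).ne'
  obtain ⟨u, p, h, hu, hpc, hhc, hu0, hp0, hmem, hpK, hhK, heq⟩ := exists_wave
    (isSelfAdjointGraph_laplacianGraph d (s / 2)) (inner_mulOp_comm hgs) (inner_mulOp_comm hms)
    (inner_mulOp_self_nonneg hb hb0)
    (mulOp_mulOp_eq_self hgs hgi fun x => mul_inv_cancel₀ (hgne x))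
    (mulOp_mulOp_eq_self hgi hgs fun x => inv_mul_cancel₀ (hgne x))
    hT.le hFc (fun t ht => (hF t ht).2) hvw hv₁.toLp
  have htd : ∀ t ∈ Icc 0 T, timeDeriv T u t = p t := fun t ht =>
    (hu t).hasDerivWithinAt.derivWithin (uniqueDiffOn_Icc hT t ht)
  set R := K₁ + √Kg * K₀ + √Km * K₀ + T * Kf with hR
  have hRle : ‖hv₁.toLp‖ + ‖mulOp hgs w‖ + ‖mulOp hms v‖ + T * Kf ≤ R := by
    have h1 := (norm_mulOp_apply_le hgs hgae w).trans
      (mul_le_mul_of_nonneg_left hwn (Real.sqrt_nonneg Kg))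
    have h2 := (norm_mulOp_apply_le hms hmae v).trans
      (mul_le_mul_of_nonneg_left hvn (Real.sqrt_nonneg Km))
    rw [hR]
    gcongr
  have hpR : ∀ t ∈ Icc 0 T, ‖p t‖ ≤ R := fun t ht => (hpK t ht).trans hRle
  refine ⟨u, ⟨memC1_of_hasDerivAt hu hpc hhc hmem, fun φ hφ t ht => ?_, ?_, ?_⟩,
    fun t ht => ?_⟩
  · obtain ⟨ψ, hψ⟩ := exists_mem_laplacianGraph hφ
    rw [fracLaplacian_eq_of_mem (hmem t ht), fracLaplacian_eq_of_mem hψ, htd t ht]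
    refine ((heq φ ψ hψ t ht).congr (fun τ hτ => ?_) ?_).congr_deriv ?_
    · rw [htd τ hτ, inner_L2_eq]
    · rw [htd t ht, inner_L2_eq]
    · rw [mulOp_mulOp hgs hgs hg (fun x => Real.mul_self_sqrt (hg0 x).le),
        mulOp_mulOp hms hms hm (fun x => Real.mul_self_sqrt (hm0 x)), inner_L2_eq, inner_L2_eq,
        inner_L2_eq, inner_L2_eq]
      congr 1
      · congr 1
        · congr 1
          · refine integral_congr_ae ?_
            filter_upwards [(hF t ht).1] with x hx
            rw [hx]
          · refine integral_congr_ae ?_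
            filter_upwards [coeFn_mulOp hg (h t)] with x hx
            rw [hx]
        · refine integral_congr_ae ?_
          filter_upwards [coeFn_mulOp hm (u t)] with x hx
          rw [hx]
      · refine integral_congr_ae ?_
        filter_upwards [coeFn_mulOp hb (p t)] with x hx
        rw [hx]
  · rw [hu0]
    exact hvv
  · rw [htd 0 ⟨le_rfl, hT.le⟩, hp0]
    exact hv₁.coeFn_toLp
  · rw [norm1, htd t ht, fracLaplacian_eq_of_mem (hmem t ht)]
    have hR0 : 0 ≤ R := (norm_nonneg _).trans (hpR t ht)
    have h1 : ‖u t‖ ≤ K₀ + T * R := by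
      have := norm_image_sub_le_of_norm_deriv_le_segment' (a := 0) (b := T) (C := R)
        (fun τ _ => (hu τ).hasDerivWithinAt) (fun τ hτ => hpR τ (Ico_subset_Icc_self hτ)) t ht
      rw [hu0, sub_zero] at this
      have h' := norm_sub_norm_le (u t) v
      have h'' : R * t ≤ T * R := by rw [mul_comm]; gcongr; exact ht.2
      linarith
    have h2 : ‖h t‖ ≤ (√c)⁻¹ * R := by
      refine (hhK t ht).trans (mul_le_mul ?_ hRle (by positivity) (by positivity))
      exact ContinuousLinearMap.opNorm_le_bound _ (by positivity) (norm_mulOp_apply_le hgi hgi')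
    have h3 := hpR t ht
    linarith [show (1 + T + (√c)⁻¹) * R = R + T * R + (√c)⁻¹ * R by ring]

end RegularProblem

/-! ### Polynomial bounds -/

section Moderate

/-- Polynomial growth in `1/ε`, for a net of real numbers. -/
def PolyBounded (k : ℝ → ℝ) : Prop :=
  ∃ N : ℕ, 0 < N ∧ ∃ C : ℝ, 0 < C ∧ ∀ ε ∈ Ioc (0 : ℝ) 1, k ε ≤ C / ε ^ N

theorem PolyBounded.mono {k k' : ℝ → ℝ} (h : PolyBounded k')
    (hk : ∀ ε ∈ Ioc (0 : ℝ) 1, k ε ≤ k' ε) : PolyBounded k := by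
  obtain ⟨N, hN, C, hC, hb⟩ := h
  exact ⟨N, hN, C, hC, fun ε hε => (hk ε hε).trans (hb ε hε)⟩

theorem polyBounded_const_div_pow (C : ℝ) (N : ℕ) : PolyBounded fun ε => C / ε ^ N := by
  refine ⟨N + 1, N.succ_pos, |C| + 1, by positivity, fun ε hε => ?_⟩
  have h0 := hε.1
  have h1 : ε ^ (N + 1) ≤ ε ^ N := pow_le_pow_of_le_one h0.le hε.2 N.le_succ
  exact div_le_div₀ (by positivity) ((le_abs_self C).trans (by linarith)) (by positivity) h1

theorem polyBounded_const (C : ℝ) : PolyBounded fun _ => C := by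
  simpa using polyBounded_const_div_pow C 0

theorem PolyBounded.add {k k' : ℝ → ℝ} (h : PolyBounded k) (h' : PolyBounded k') :
    PolyBounded fun ε => k ε + k' ε := by
  obtain ⟨N, hN, C, hC, hb⟩ := h
  obtain ⟨N', -, C', hC', hb'⟩ := h'
  refine ⟨N + N', by omega, C + C', by positivity, fun ε hε => ?_⟩
  have h0 := hε.1
  have h1 : ε ^ (N + N') ≤ ε ^ N := pow_le_pow_of_le_one h0.le hε.2 (by omega)
  have h2 : ε ^ (N + N') ≤ ε ^ N' := pow_le_pow_of_le_one h0.le hε.2 (by omega)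
  rw [add_div]
  exact add_le_add ((hb ε hε).trans (by gcongr)) ((hb' ε hε).trans (by gcongr))

theorem PolyBounded.mul {k k' : ℝ → ℝ} (h : PolyBounded k) (h' : PolyBounded k')
    (hk' : ∀ ε ∈ Ioc (0 : ℝ) 1, 0 ≤ k' ε) :
    PolyBounded fun ε => k ε * k' ε := by
  obtain ⟨N, hN, C, hC, hb⟩ := h
  obtain ⟨N', -, C', hC', hb'⟩ := h'
  refine ⟨N + N', by omega, C * C', by positivity, fun ε hε => ?_⟩
  have h0 := hε.1
  rw [pow_add, ← div_mul_div_comm]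
  exact mul_le_mul (hb ε hε) (hb' ε hε) (hk' ε hε) (by positivity)

theorem PolyBounded.sqrt {k : ℝ → ℝ} (h : PolyBounded k) : PolyBounded fun ε => √(k ε) := by
  obtain ⟨N, hN, C, hC, hb⟩ := h
  refine ((polyBounded_const 1).add (polyBounded_const_div_pow C N)).mono fun ε hε => ?_
  have h0 := hε.1
  refine Real.sqrt_le_iff.2 ⟨by positivity, (hb ε hε).trans ?_⟩
  have : 0 ≤ C / ε ^ N := by positivity
  nlinarith

end Moderate

end VeryWeak

theorem theorem4p4 (d : ℕ) (s T : ℝ) (hs : 0 < s) (hT : 0 < T)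
    (g m b : 𝓓'((⊤ : TopologicalSpace.Opens (VeryWeak.Space d)), ℝ))
    (f : ℝ → 𝓓'((⊤ : TopologicalSpace.Opens (VeryWeak.Space d)), ℂ))
    (u₀ u₁ : 𝓓'((⊤ : TopologicalSpace.Opens (VeryWeak.Space d)), ℂ))
    (gε mε bε : ℝ → VeryWeak.Space d → ℝ) (fε : ℝ → ℝ → VeryWeak.Space d → ℂ)
    (u₀ε u₁ε : ℝ → VeryWeak.Space d → ℂ)
    (hreg : VeryWeak.ModerateRegularisations s T g m b f u₀ u₁ gε mε bε fε u₀ε u₁ε)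
    (hlow : ∃ N : ℕ, ∃ c : ℝ, 0 < c ∧ ∀ ε ∈ Ioc (0 : ℝ) 1, ∀ x, c * ε ^ N ≤ gε ε x) :
    ∃ u : ℝ → ℝ → VeryWeak.L2 d,
      VeryWeak.IsVeryWeakSolution s T g m b f u₀ u₁ u ∧
      VeryWeak.SolvesRegularised s T gε mε bε fε u₀ε u₁ε u := by
  obtain ⟨N, c, hc, hlow⟩ := hlow
  obtain ⟨Ng, -, Cg, hCg, hg⟩ := hreg.moderate_g
  obtain ⟨Nm, -, Cm, hCm, hm⟩ := hreg.moderate_m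
  obtain ⟨Nb, -, Cb, hCb, hb⟩ := hreg.moderate_b
  obtain ⟨Nf, -, Cf, hCf, hf⟩ := hreg.moderate_f
  obtain ⟨N₀, -, C₀, hC₀, hv₀⟩ := hreg.moderate_u₀
  obtain ⟨N₁, -, C₁, hC₁, hv₁⟩ := hreg.moderate_u₁
  have hsol : ∀ ε ∈ Ioc (0 : ℝ) 1, ∃ u : ℝ → VeryWeak.L2 d,
      VeryWeak.IsSolution s T (gε ε) (mε ε) (bε ε) (fε ε) (u₀ε ε) (u₁ε ε) u ∧
      ∀ t ∈ Icc 0 T, VeryWeak.norm1 s T u t ≤ C₀ / ε ^ N₀ + (1 + T + √(c⁻¹ / ε ^ N)) *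
        (C₁ / ε ^ N₁ + √(Cg / ε ^ Ng) * (C₀ / ε ^ N₀) + √(Cm / ε ^ Nm) * (C₀ / ε ^ N₀)
          + T * (Cf / ε ^ Nf)) := by
    intro ε hε
    have h0 := hε.1
    have hcε : c⁻¹ / ε ^ N = (c * ε ^ N)⁻¹ := by rw [mul_inv, div_eq_mul_inv]
    rw [hcε, Real.sqrt_inv]
    exact VeryWeak.exists_isSolution hT (by positivity) (by positivity) (by positivity)
      (by positivity) (by positivity) (by positivity) (hg ε hε).1 (hg ε hε).2 (hlow ε hε)
      (hm ε hε).1 (hm ε hε).2 (hreg.nonneg_m ε hε) (hb ε hε).1 (hreg.nonneg_b ε hε) (hf ε hε)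
      (hv₀ ε hε) (hv₁ ε hε).1 (hv₁ ε hε).2
  choose! u hu hun using hsol
  refine ⟨u, ⟨gε, mε, bε, fε, u₀ε, u₁ε, hreg, hu, fun ε hε => (hu ε hε).memC1, ?_⟩, hu⟩
  have hpoly : ∀ C N, VeryWeak.PolyBounded fun ε => C / ε ^ N := VeryWeak.polyBounded_const_div_pow
  have hpos : ∀ {C : ℝ} {N : ℕ}, 0 < C → ∀ ε ∈ Ioc (0 : ℝ) 1, 0 ≤ C / ε ^ N := fun hC ε hε => by
    have := hε.1
    positivity
  have hR := ((((hpoly C₁ N₁).add ((hpoly Cg Ng).sqrt.mul (hpoly C₀ N₀) (hpos hC₀))).add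
    ((hpoly Cm Nm).sqrt.mul (hpoly C₀ N₀) (hpos hC₀))).add
    ((VeryWeak.polyBounded_const T).mul (hpoly Cf Nf) (hpos hCf)))
  obtain ⟨M, hM, C, hC, hb⟩ := (hpoly C₀ N₀).add
    (((VeryWeak.polyBounded_const (1 + T)).add (hpoly c⁻¹ N).sqrt).mul hR fun ε hε => by
      have := hε.1
      positivity)
  exact ⟨M, hM, C, hC, fun ε hε t ht => (hun ε hε t ht).trans (hb ε hε)⟩
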